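/- Let $G=(V,E)$ be a finite simple graph of treewidth $k>1$ with a planar embedding $\varphi$: distinct vertices are mapped to distinct points of the Euclidean plane, every edge to a simple arc joining its end vertices, an arc contains no vertex other than its two ends, and two distinct arcs meet only in common end vertices. The \emph{coast} of an embedded graph is the set of its vertices that are incident to the outer (unbounded) face. The \emph{height} $h_\varphi(v)$ of a vertex is defined inductively: the vertices of height $1$ are those of the coast of $G$, and, for $i>1$, the vertices of height $i$ are those of the coast of the embedded subgraph obtained from $G$ by removing all vertices of height smaller than $i$. Let $V_1,V_2\subseteq V$ be non-empty sets that each induce a connected subgraph of $G$, and suppose that $$\Bigl(\min_{v\in V_2}h_\varphi(v)\Bigr)-\Bigl(\max_{v\in V_1}h_\varphi(v)\Bigr)\ \ge\ k+1 .$$ Then there is a set $Y\subseteq V$ with $|Y|\le k$ that strongly disconnects $V_1$ and $V_2$; that is, $Y\cap(V_1\cup V_2)=\emptyset$ and no connected component of $G-Y$ contains both a vertex of $V_1$ and a vertex of $V_2$. -/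

import Mathlib

namespace PlaneGraph

/-- The Euclidean plane. -/
abbrev Plane : Type := EuclideanSpace ℝ (Fin 2)

/-- `A` is a simple arc in the plane with end points `x` and `y`: the range of an injective
continuous map on the unit interval that starts in `x` and ends in `y`. -/
def IsArc (x y : Plane) (A : Set Plane) : Prop :=
  ∃ γ : unitInterval → Plane,
    Continuous γ ∧ Function.Injective γ ∧ γ 0 = x ∧ γ 1 = y ∧ Set.range γ = A

/-- A planar embedding of a graph `G`: the vertices are distinct points of the plane, each edge is
a simple arc between its two end vertices, an arc contains no vertex but the ends of its edge, and
two different arcs meet only in common end vertices. -/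
structure PlanarEmbedding {V : Type*} (G : SimpleGraph V) where
  pos : V → Plane
  pos_injective : Function.Injective pos
  arc : G.edgeSet → Set Plane
  isArc_arc : ∀ (u v : V) (h : G.Adj u v), IsArc (pos u) (pos v) (arc ⟨s(u, v), h⟩)
  mem_of_pos_mem_arc : ∀ (w : V) (e : G.edgeSet), pos w ∈ arc e → w ∈ (e : Sym2 V)
  arc_inter_arc : ∀ e f : G.edgeSet, e ≠ f → ∀ x ∈ arc e ∩ arc f,
    ∃ w : V, w ∈ (e : Sym2 V) ∧ w ∈ (f : Sym2 V) ∧ x = pos w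

namespace PlanarEmbedding

variable {V : Type*} {G : SimpleGraph V}

/-- The point set in the plane occupied by the induced subgraph `G[S]`, under the restriction of
the embedding to the vertices and edges of `G[S]`. -/
def drawing (φ : PlanarEmbedding G) (S : Set V) : Set Plane :=
  φ.pos '' S ∪ ⋃ (e : G.edgeSet) (_ : ∀ w ∈ (e : Sym2 V), w ∈ S), φ.arc e

/-- The outer face of the embedded graph `G[S]`: the unbounded connected component of the
complement of its drawing. -/
def outerFace (φ : PlanarEmbedding G) (S : Set V) : Set Plane :=
  {x | x ∈ (φ.drawing S)ᶜ ∧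
    ¬ Bornology.IsBounded (connectedComponentIn (φ.drawing S)ᶜ x)}

/-- The coast of the embedded graph `G[S]`: its vertices that are incident to the outer face,
that is, lie on the boundary of the outer face. -/
def coast (φ : PlanarEmbedding G) (S : Set V) : Set V :=
  {v | v ∈ S ∧ φ.pos v ∈ frontier (φ.outerFace S)}

/-- The vertices that remain after `i` rounds, each of which removes the whole coast of the
embedded graph that is left; these are the vertices of height larger than `i`. -/
def remaining (φ : PlanarEmbedding G) : ℕ → Set V
  | 0 => Set.univ
  | i + 1 => φ.remaining i \ φ.coast (φ.remaining i)

/-- The height of a vertex: the number of the round in which it is removed. The coast of `G` has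
height 1, and the vertices of height `i > 1` are the coast of what is left when all vertices of
height smaller than `i` are removed. (The value would be `⊤` for a vertex never removed.) -/
noncomputable def height (φ : PlanarEmbedding G) (v : V) : ℕ∞ :=
  ⨅ (i : ℕ) (_ : v ∉ φ.remaining i), (i : ℕ∞)

end PlanarEmbedding

/-- A tree decomposition of `G` whose tree has the node set `ι`. -/
structure TreeDecomposition {V : Type*} (G : SimpleGraph V) (ι : Type) where
  tree : SimpleGraph ι
  isTree : tree.IsTree
  bag : ι → Finset V
  exists_mem_bag : ∀ v : V, ∃ t : ι, v ∈ bag t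
  exists_edge_subset_bag : ∀ u v : V, G.Adj u v → ∃ t : ι, u ∈ bag t ∧ v ∈ bag t
  connected_nodes : ∀ v : V, (tree.induce {t | v ∈ bag t}).Connected

/-- The width of a tree decomposition: the largest size of a bag, minus one. -/
def TreeDecomposition.width {V : Type*} {G : SimpleGraph V} {n : ℕ}
    (D : TreeDecomposition G (Fin n)) : ℕ :=
  (Finset.univ.sup fun t => (D.bag t).card) - 1

/-- The treewidth of a finite graph: the smallest width of a tree decomposition. -/
noncomputable def treewidth {V : Type*} (G : SimpleGraph V) : ℕ :=
  sInf {k | ∃ (n : ℕ) (D : TreeDecomposition G (Fin n)), D.width = k}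

/-- `S` disconnects `A` and `B` weakly: no connected component of `G - S` contains vertices of
both `A` and `B`. -/
def WeaklyDisconnects {V : Type*} (G : SimpleGraph V) (S A B : Set V) : Prop :=
  ¬ ∃ C : (G.induce Sᶜ).ConnectedComponent,
    (∃ a ∈ C.supp, (a : V) ∈ A) ∧ (∃ b ∈ C.supp, (b : V) ∈ B)

/-- `S` disconnects `A` and `B` strongly: it disconnects them weakly and meets neither. -/
def StronglyDisconnects {V : Type*} (G : SimpleGraph V) (S A B : Set V) : Prop :=
  WeaklyDisconnects G S A B ∧ S ∩ (A ∪ B) = ∅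

end PlaneGraph

/-! The coasts of the graphs left after `a, …, a + k - 1` rounds are disjoint, and each of them lies
between `V₁` and `V₂`. From each coast one connected component is chosen that meets every connected
set meeting both `V₁` and `V₂` (`exists_separating_coast_part`). With `V₁` and `V₂` these are `k +
2` disjoint connected sets, while a bag has at most `k + 1` vertices. By the Helly property of
subtrees, two of the `k + 2` corresponding subtrees are disjoint, and the intersection of two
adjacent bags between them is a set of at most `k` vertices separating the two sets
(`exists_separator`). Its part outside `V₁ ∪ V₂` is the desired `Y`: a walk from `V₁` to `V₂`
avoiding `Y` would yield a connected set that avoids the separator but meets both of the separated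
sets (`exists_stronglyDisconnects`).

That a single component of a coast suffices is a fact of plane topology (`reachIn_coast`). If a
connected set inside the coast had neighbours in two components, neither one component nor the rest
of the coast would separate it from the outer face. These two drawings are compact and disjoint, so
by Janiszewski's theorem their union does not separate either; but that union contains the frontier
of the outer face (`frontier_outerFace_subset_drawing_coast`).

Janiszewski's theorem follows from Eilenberg's criterion: a compact `K` does not separate `a` from
`b` exactly when `(z - a) / (z - b)` has a continuous logarithm on `K`. -/

open Set Topology

/-! ### Continuous logarithms on sets -/

/-- `x` and `y` lie in a connected set that avoids `K`. -/
def JoinedOff {E : Type*} [TopologicalSpace E] (K : Set E) (x y : E) : Prop :=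
  ∃ S, IsPreconnected S ∧ x ∈ S ∧ y ∈ S ∧ Disjoint S K

/-- `f` has a continuous logarithm on `K`. -/
def HasLogOn {E : Type*} [TopologicalSpace E] (f : E → ℂ) (K : Set E) : Prop :=
  ∃ g : E → ℂ, ContinuousOn g K ∧ ∀ z ∈ K, Complex.exp (g z) = f z

section General

variable {E : Type*} [TopologicalSpace E]

theorem IsPreconnected.inter_frontier_nonempty {S F : Set E} (hS : IsPreconnected S)
    (h1 : (S ∩ F).Nonempty) {x : E} (hx : x ∈ S) (hxF : x ∉ F) : (S ∩ frontier F).Nonempty := by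
  by_contra hne
  rw [not_nonempty_iff_eq_empty] at hne
  have hcov : S ⊆ interior F ∪ (closure F)ᶜ := by
    intro z hz
    by_cases hzi : z ∈ interior F
    · exact Or.inl hzi
    · refine Or.inr fun hzc => ?_
      have : z ∈ S ∩ frontier F := ⟨hz, hzc, hzi⟩
      rw [hne] at this
      exact this
  obtain ⟨y, hyS, hyF⟩ := h1
  have hyi : y ∈ interior F := (hcov hyS).resolve_right fun h => h (subset_closure hyF)
  have hsub := hS.subset_left_of_subset_union isOpen_interior isClosed_closure.isOpen_compl
    (disjoint_compl_right_iff_subset.2 (interior_subset.trans subset_closure)) hcov ⟨y, hyS, hyi⟩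
  exact hxF (interior_subset (hsub hx))

theorem HasLogOn.mul {f g : E → ℂ} {K : Set E} (hf : HasLogOn f K) (hg : HasLogOn g K) :
    HasLogOn (fun z => f z * g z) K := by
  obtain ⟨a, ha, ha'⟩ := hf
  obtain ⟨b, hb, hb'⟩ := hg
  exact ⟨fun z => a z + b z, ha.add hb, fun z hz => by
    simp only [Complex.exp_add, ha' z hz, hb' z hz]⟩

theorem HasLogOn.inv {f : E → ℂ} {K : Set E} (hf : HasLogOn f K) :
    HasLogOn (fun z => (f z)⁻¹) K := by
  obtain ⟨a, ha, ha'⟩ := hf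
  exact ⟨fun z => - a z, ha.neg, fun z hz => by
    simp only [Complex.exp_neg, ha' z hz]⟩

theorem HasLogOn.congr {f g : E → ℂ} {K : Set E} (hf : HasLogOn f K) (h : EqOn f g K) :
    HasLogOn g K := by
  obtain ⟨a, ha, ha'⟩ := hf
  exact ⟨a, ha, fun z hz => by rw [ha' z hz, h hz]⟩

theorem exp_eq_one_const {Q : Set E} (hQ : IsPreconnected Q) {d : E → ℂ} (hd : ContinuousOn d Q)
    (h : ∀ z ∈ Q, Complex.exp (d z) = 1) : ∃ n : ℤ, ∀ z ∈ Q, d z = n * (2 * Real.pi * Complex.I) := by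
  rcases Q.eq_empty_or_nonempty with rfl | ⟨z₀, hz₀⟩
  · exact ⟨0, by simp⟩
  obtain ⟨n, hn⟩ := Complex.exp_eq_one_iff.1 (h z₀ hz₀)
  refine ⟨n, fun z hz => ?_⟩
  have hpi : (2 * Real.pi * Complex.I : ℂ) ≠ 0 := Complex.two_pi_I_ne_zero
  have hc : ContinuousOn (fun z => (d z / (2 * Real.pi * Complex.I)).re) Q :=
    Complex.continuous_re.comp_continuousOn (hd.div_const _)
  have key : ∀ w ∈ Q, ∃ m : ℤ, d w = m * (2 * Real.pi * Complex.I) ∧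
      (d w / (2 * Real.pi * Complex.I)).re = m := by
    intro w hw
    obtain ⟨m, hm⟩ := Complex.exp_eq_one_iff.1 (h w hw)
    refine ⟨m, hm, ?_⟩
    rw [hm, mul_div_cancel_right₀ _ hpi]
    simp
  have hpre := (hQ.image _ hc)
  obtain ⟨m, hm, hm'⟩ := key z hz
  obtain ⟨m₀, hm₀, hm₀'⟩ := key z₀ hz₀
  have aux : ∀ u ∈ Q, ∀ v ∈ Q, ∀ p q : ℤ, (d u / (2 * Real.pi * Complex.I)).re = p →
      (d v / (2 * Real.pi * Complex.I)).re = q → ¬ p < q := by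
    intro u hu v hv p q hp hq hlt
    -- By connectedness the half-integer `p + 1 / 2` would be a value of a function that takes only
    -- integer values.
    have : ((p : ℝ) + 1 / 2) ∈ Icc (d u / (2 * Real.pi * Complex.I)).re
        (d v / (2 * Real.pi * Complex.I)).re := by
      rw [hp, hq]
      have : (p : ℝ) + 1 ≤ q := by exact_mod_cast hlt
      constructor <;> linarith
    obtain ⟨w, hw, hw'⟩ := hpre.ordConnected.out (mem_image_of_mem _ hu) (mem_image_of_mem _ hv) this
    obtain ⟨r, -, hr⟩ := key w hw
    simp only [hr] at hw'
    have h2 : (2 * r : ℝ) = 2 * p + 1 := by linarith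
    have h3 : 2 * r = 2 * p + 1 := by exact_mod_cast h2
    omega
  have hmm : m = m₀ := le_antisymm (not_lt.1 (aux z₀ hz₀ z hz m₀ m hm₀' hm'))
    (not_lt.1 (aux z hz z₀ hz₀ m m₀ hm' hm₀'))
  have : m₀ = n := by
    have := hm₀.symm.trans hn
    have := mul_right_cancel₀ hpi this
    exact_mod_cast this
  rw [hm, hmm, this]

/-- On the connected set `A ∩ B` the two logarithms differ by one constant multiple of `2πi`;
shifting one of them by it makes them agree there, and they glue because both sets are closed. -/
theorem HasLogOn.union {f : E → ℂ} {A B : Set E} (hA : IsClosed A) (hB : IsClosed B)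
    (hAB : IsPreconnected (A ∩ B)) (hf : HasLogOn f A) (hg : HasLogOn f B) :
    HasLogOn f (A ∪ B) := by
  obtain ⟨a, ha, ha'⟩ := hf
  obtain ⟨b, hb, hb'⟩ := hg
  obtain ⟨n, hn⟩ := exp_eq_one_const hAB (d := fun z => a z - b z)
    ((ha.mono inter_subset_left).sub (hb.mono inter_subset_right)) (fun z hz => by
      rw [Complex.exp_sub, ha' z hz.1, hb' z hz.2, div_self]
      rw [← ha' z hz.1]; exact Complex.exp_ne_zero _)
  classical
  let g : E → ℂ := fun z => if z ∈ A then a z else b z + n * (2 * Real.pi * Complex.I)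
  have gA : EqOn g a A := fun z hz => if_pos hz
  have gB : EqOn g (fun z => b z + n * (2 * Real.pi * Complex.I)) B := by
    intro z hz
    by_cases hzA : z ∈ A
    · rw [gA hzA]
      have := hn z ⟨hzA, hz⟩
      simp only [← this]; ring
    · exact if_neg hzA
  refine ⟨g, ContinuousOn.union_of_isClosed (ha.congr gA) ((hb.add continuousOn_const).congr gB) hA hB, ?_⟩
  rintro z (hz | hz)
  · rw [gA hz, ha' z hz]
  · rw [gB hz, Complex.exp_add, hb' z hz, Complex.exp_int_mul_two_pi_mul_I, mul_one]

end General

/-! ### Logarithms of nonvanishing functions in the complex plane -/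

theorem hasLogOn_univ {A : Type*} [TopologicalSpace A] [SimplyConnectedSpace A]
    [LocallyPathConnectedSpace A] {f : A → ℂ} (hf : Continuous f) (h0 : ∀ z, f z ≠ 0) :
    ∃ g : A → ℂ, Continuous g ∧ ∀ z, Complex.exp (g z) = f z := by
  let f' : C(A, {z : ℂ // z ≠ 0}) := ⟨fun z => ⟨f z, h0 z⟩, by fun_prop⟩
  obtain ⟨a₀⟩ : Nonempty A := inferInstance
  obtain ⟨F, ⟨-, hF⟩, -⟩ := Complex.isCoveringMap_exp.existsUnique_continuousMap_lifts f'
    (a₀ := a₀) (e₀ := Complex.log (f a₀)) (Subtype.ext (Complex.exp_log (h0 a₀)))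
  exact ⟨F, F.continuous, fun z => congrArg Subtype.val (congrFun hF z)⟩

theorem hasLog_unitInterval {f : unitInterval → ℂ} (hf : Continuous f) (h0 : ∀ z, f z ≠ 0) :
    ∃ g : unitInterval → ℂ, Continuous g ∧ ∀ z, Complex.exp (g z) = f z := by
  let f' : C(unitInterval, {z : ℂ // z ≠ 0}) := ⟨fun z => ⟨f z, h0 z⟩, by fun_prop⟩
  refine ⟨_, (Complex.isCoveringMap_exp.liftPath f' (Complex.log (f 0))
    (Subtype.ext (Complex.exp_log (h0 0)).symm)).continuous, fun z => ?_⟩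
  exact congrArg Subtype.val (congrFun (Complex.isCoveringMap_exp.liftPath_lifts f' (Complex.log (f 0))
    (Subtype.ext (Complex.exp_log (h0 0)).symm)) z)

/-- A continuous nonvanishing function on an arc has a logarithm. -/
theorem hasLogOn_arc {E : Type*} [TopologicalSpace E] [T2Space E] {γ : unitInterval → E}
    (hγ : Continuous γ) (hi : Function.Injective γ) {f : E → ℂ} (hf : ContinuousOn f (range γ))
    (h0 : ∀ z ∈ range γ, f z ≠ 0) : HasLogOn f (range γ) := by
  have hemb : IsClosedEmbedding γ := hγ.isClosedEmbedding hi
  obtain ⟨g, hg, hg'⟩ := hasLog_unitInterval (f := fun t => f (γ t))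
    (hf.comp_continuous hγ fun t => mem_range_self t) (fun t => h0 _ (mem_range_self t))
  refine ⟨Function.extend γ g 0, ?_, ?_⟩
  · rw [continuousOn_iff_continuous_domRestrict]
    let e := hemb.isEmbedding.toHomeomorph
    have : (range γ).domRestrict (Function.extend γ g 0) = g ∘ e.symm := by
      funext z
      obtain ⟨t, rfl⟩ := e.surjective z
      simp only [domRestrict_apply, Function.comp, Homeomorph.symm_apply_apply]
      exact hi.extend_apply g 0 t
    rw [this]
    exact hg.comp e.symm.continuous
  · rintro _ ⟨t, rfl⟩
    rw [hi.extend_apply]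
    exact hg' t

/-- Along the circle a logarithm would differ from `log R + iθ` by a constant, yet it returns to its
value at `θ = 2π` while `iθ` does not. -/
theorem not_hasLogOn_circle (a : ℂ) {R : ℝ} (hR : 0 < R) :
    ¬ HasLogOn (fun z => z - a) (Metric.sphere a R) := by
  rintro ⟨g, hg, hg'⟩
  have hmem : ∀ θ : ℝ, circleMap a R θ ∈ Metric.sphere a R := circleMap_mem_sphere a hR.le
  obtain ⟨n, hn⟩ := exp_eq_one_const (E := ℝ) isPreconnected_univ
    (d := fun θ => g (circleMap a R θ) - (Real.log R + θ * Complex.I)) (by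
      rw [continuousOn_univ]
      exact (hg.comp_continuous (continuous_circleMap a R) hmem).sub (by fun_prop)) (fun θ _ => by
      rw [Complex.exp_sub, hg' _ (hmem θ), Complex.exp_add, ← Complex.ofReal_exp, Real.exp_log hR]
      simp only [circleMap, add_sub_cancel_left]
      refine div_self ?_
      exact mul_ne_zero (by exact_mod_cast hR.ne') (Complex.exp_ne_zero _))
  have h1 := hn 0 trivial
  have h2 := hn (2 * Real.pi) trivial
  have hper : circleMap a R (2 * Real.pi) = circleMap a R 0 := by
    simpa using periodic_circleMap a R 0
  simp only [hper] at h2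
  rw [← h1] at h2
  have h3 : ((2 * Real.pi : ℝ) : ℂ) * Complex.I = 0 := by
    simp only [Complex.ofReal_zero, zero_mul, add_zero] at h2
    linear_combination -h2
  simp [Real.pi_ne_zero] at h3

/-- For `y` close to `x` the quotient `(z - y) / (z - x)` stays within distance less than 1 of 1 on
`K`, so the principal branch applies. Such quotients multiply along the connected set joining `a` to
`b`. -/
theorem JoinedOff.hasLogOn {K : Set ℂ} (hK : IsClosed K) {a b : ℂ} (h : JoinedOff K a b) :
    HasLogOn (fun z => (z - a) / (z - b)) K := by
  obtain ⟨S, hS, ha, hb, hd⟩ := h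
  have hne : ∀ x ∈ S, ∀ z ∈ K, z - x ≠ 0 := fun x hx z hz h0 =>
    Set.disjoint_left.1 hd hx (sub_eq_zero.1 h0 ▸ hz)
  refine hS.induction₂' (fun a b => HasLogOn (fun z => (z - a) / (z - b)) K) ?_ ?_ ha hb
  · intro x hx
    have hxK : Kᶜ ∈ 𝓝 x := hK.isOpen_compl.mem_nhds (Set.disjoint_left.1 hd hx)
    obtain ⟨ε, hε, hball⟩ := Metric.mem_nhds_iff.1 hxK
    have hev : ∀ᶠ y in 𝓝[S] x, y ∈ Metric.ball x ε :=
      nhdsWithin_le_nhds (Metric.ball_mem_nhds x hε)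
    filter_upwards [hev, self_mem_nhdsWithin] with y hy hyS
    have key : HasLogOn (fun z => (z - y) / (z - x)) K := by
      refine ⟨fun z => Complex.log ((z - y) / (z - x)), ?_, fun z hz =>
        Complex.exp_log (div_ne_zero (hne y hyS z hz) (hne x hx z hz))⟩
      refine ContinuousOn.clog ?_ ?_
      · exact ContinuousOn.div (by fun_prop) (by fun_prop) (hne x hx)
      · intro z hz
        have h1 : ε ≤ ‖z - x‖ := by
          by_contra hlt
          exact hball (by simpa [dist_eq_norm] using hlt) hz
        have h2 : ‖y - x‖ < ε := by simpa [dist_eq_norm] using hy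
        have h3 : (z - y) / (z - x) = 1 + (x - y) / (z - x) := by
          field_simp [hne x hx z hz]; ring
        rw [h3]
        refine Complex.mem_slitPlane_of_norm_lt_one ?_
        rw [norm_div, div_lt_one (hε.trans_le h1), norm_sub_rev]
        exact h2.trans_le h1
    exact ⟨key.inv.congr fun z _ => by simp, key⟩
  · intro x y w hx hy hw h1 h2
    refine (h1.mul h2).congr fun z hz => ?_
    have := hne y hy z hz
    have := hne w hw z hz
    simp only
    field_simp

/-- If the frontier of a bounded open set with `a` inside and `b` outside lies in `K`, then
`(z - a) / (z - b)` has no logarithm on `K`. -/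
theorem not_hasLogOn_of_frontier_subset {K U : Set ℂ} (hK : IsClosed K)
    (hU : Bornology.IsBounded U) (hfr : frontier U ⊆ K) {a b : ℂ}
    (ha : a ∈ U) (hb : b ∉ closure U) : ¬ HasLogOn (fun z => (z - a) / (z - b)) K := by
  rintro ⟨g, hg, hg'⟩
  obtain ⟨G, hG⟩ := ContinuousMap.exists_restrict_eq hK ⟨K.domRestrict g, hg.domRestrict⟩
  have hG' : ∀ z ∈ K, G z = g z := fun z hz => congrArg (fun f => f ⟨z, hz⟩) hG
  classical
  -- The logarithm, extended by Tietze's theorem, replaces `z - a` inside `U` by a function without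
  -- zeros. The two formulas agree on the frontier, and on a large circle `h` is still `z - a`.
  let h : ℂ → ℂ := fun z => if z ∈ U then Complex.exp (G z) * (z - b) else z - a
  have hc : Continuous h := by
    refine continuous_if (fun z hz => ?_) ?_ (by fun_prop)
    · have hzK : z ∈ K := hfr hz
      have hzb : z - b ≠ 0 := fun h0 => hb (sub_eq_zero.1 h0 ▸ frontier_subset_closure hz)
      rw [hG' z hzK, hg' z hzK, div_mul_cancel₀ _ hzb]
    · have := G.continuous
      fun_prop
  have h0 : ∀ z, h z ≠ 0 := by
    intro z
    by_cases hz : z ∈ U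
    · simp only [h, if_pos hz]
      exact mul_ne_zero (Complex.exp_ne_zero _)
        fun h0 => hb (sub_eq_zero.1 h0 ▸ subset_closure hz)
    · simp only [h, if_neg hz]
      exact fun h0 => hz (sub_eq_zero.1 h0 ▸ ha)
  obtain ⟨L, hL, hL'⟩ := hasLogOn_univ hc h0
  obtain ⟨R, hR⟩ := hU.subset_ball a
  have hRpos : 0 < R := Metric.pos_of_mem_ball (hR ha)
  refine not_hasLogOn_circle a hRpos ⟨L, hL.continuousOn, fun z hz => ?_⟩
  rw [hL']
  refine if_neg fun hzU => ?_
  have := hR hzU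
  rw [Metric.mem_ball] at this
  exact absurd (Metric.mem_sphere.1 hz) this.ne

/-! ### Components of the complement of a bounded set -/

theorem subset_connectedComponentIn_of_unbounded {E : Type*} [NormedAddCommGroup E] {T S : Set E} {x : E} (hS : S ⊆ T)
    (hSp : IsPreconnected S) (hSb : Bornology.IsBounded Sᶜ)
    (hx : ¬ Bornology.IsBounded (connectedComponentIn T x)) : S ⊆ connectedComponentIn T x := by
  have : (connectedComponentIn T x ∩ S).Nonempty := by
    by_contra h
    rw [not_nonempty_iff_eq_empty, ← disjoint_iff_inter_eq_empty] at h
    exact hx (hSb.subset h.subset_compl_right)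
  obtain ⟨y, hy, hyS⟩ := this
  rw [connectedComponentIn_eq hy]
  exact hSp.subset_connectedComponentIn hyS hS

section Components

variable {E : Type*} [NormedAddCommGroup E] [NormedSpace ℝ E]

theorem frontier_connectedComponentIn_compl_subset {K : Set E} (hK : IsClosed K) (x : E) :
    frontier (connectedComponentIn Kᶜ x) ⊆ K := by
  intro p hp
  by_contra hpK
  have hopen := hK.isOpen_compl.connectedComponentIn (x := x)
  have hpo := hK.isOpen_compl.connectedComponentIn (x := p)
  obtain ⟨q, hq1, hq2⟩ := mem_closure_iff.1 hp.1 _ hpo (mem_connectedComponentIn hpK)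
  have : connectedComponentIn Kᶜ x = connectedComponentIn Kᶜ p :=
    (connectedComponentIn_eq hq2).trans (connectedComponentIn_eq hq1).symm
  rw [hopen.frontier_eq] at hp
  exact hp.2 (this ▸ mem_connectedComponentIn hpK)

theorem isPreconnected_compl_closedBall (hE : 1 < Module.rank ℝ E) {R : ℝ} (hR : 0 < R) :
    IsPreconnected (Metric.closedBall (0 : E) R)ᶜ := by
  -- Pushing each nonzero vector outward by `R` along its ray maps the punctured space onto the
  -- complement of the ball.
  have himg : (Metric.closedBall (0 : E) R)ᶜ =
      (fun z : E => (1 + R / ‖z‖) • z) '' ({0}ᶜ : Set E) := by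
    ext w
    simp only [mem_compl_iff, Metric.mem_closedBall, dist_zero_right, not_le, mem_image,
      mem_singleton_iff]
    constructor
    · intro hw
      have hw0 : 0 < ‖w‖ := hR.trans hw
      have h1 : ‖(1 - R / ‖w‖) • w‖ = ‖w‖ - R := by
        rw [norm_smul, Real.norm_of_nonneg (by rw [sub_nonneg, div_le_one hw0]; exact hw.le)]
        field_simp
      refine ⟨(1 - R / ‖w‖) • w, ?_, ?_⟩
      · rw [← Ne, ← norm_ne_zero_iff, h1]; linarith
      · have h2 : ‖w‖ - R ≠ 0 := by linarith
        simp only [h1, smul_smul]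
        have : (1 + R / (‖w‖ - R)) * (1 - R / ‖w‖) = 1 := by
          field_simp
          ring
        rw [this, one_smul]
    · rintro ⟨z, hz, rfl⟩
      have hz0 : 0 < ‖z‖ := norm_pos_iff.2 hz
      rw [norm_smul, Real.norm_of_nonneg (by positivity), add_mul, div_mul_cancel₀ _ hz0.ne']
      linarith
  rw [himg]
  refine (isConnected_compl_singleton_of_one_lt_rank hE 0).isPreconnected.image _ ?_
  refine ContinuousOn.smul (continuousOn_const.add (continuousOn_const.div continuousOn_id.norm ?_))
    continuousOn_id
  intro z hz
  simpa using hz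

theorem exists_preconnected_subset_compl (hE : 1 < Module.rank ℝ E) {K : Set E}
    (hK : Bornology.IsBounded K) : ∃ S ⊆ Kᶜ, IsPreconnected S ∧ Bornology.IsBounded Sᶜ := by
  obtain ⟨R, hRpos, hR⟩ := hK.subset_closedBall_lt 0 (0 : E)
  exact ⟨_, compl_subset_compl.2 hR, isPreconnected_compl_closedBall hE hRpos, by
    rw [compl_compl]; exact Metric.isBounded_closedBall⟩

theorem connectedComponentIn_eq_of_unbounded (hE : 1 < Module.rank ℝ E) {K : Set E}
    (hK : Bornology.IsBounded K) {x y : E}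
    (hx : ¬ Bornology.IsBounded (connectedComponentIn Kᶜ x))
    (hy : ¬ Bornology.IsBounded (connectedComponentIn Kᶜ y)) :
    connectedComponentIn Kᶜ x = connectedComponentIn Kᶜ y := by
  obtain ⟨S, hS, hSp, hSb⟩ := exists_preconnected_subset_compl hE hK
  have h1 := subset_connectedComponentIn_of_unbounded hS hSp hSb hx
  have h2 := subset_connectedComponentIn_of_unbounded hS hSp hSb hy
  have : S.Nonempty := by
    by_contra h
    rw [not_nonempty_iff_eq_empty] at h
    rw [h, compl_empty] at hSb
    exact hx (hSb.subset (subset_univ _))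
  obtain ⟨z, hz⟩ := this
  exact (connectedComponentIn_eq (h1 hz)).trans (connectedComponentIn_eq (h2 hz)).symm

end Components

/-! ### Eilenberg's criterion and Janiszewski's theorem -/

/-- Eilenberg's criterion. -/
theorem HasLogOn.joinedOff {K : Set ℂ} (hK : IsCompact K) {a b : ℂ} (ha : a ∉ K) (hb : b ∉ K)
    (h : HasLogOn (fun z => (z - a) / (z - b)) K) : JoinedOff K a b := by
  by_contra hnot
  have hdisj : ∀ x y, connectedComponentIn Kᶜ x = connectedComponentIn Kᶜ y → x ∉ K → y ∉ K →
      JoinedOff K x y := fun x y hxy hx hy =>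
    ⟨_, isPreconnected_connectedComponentIn (x := x), mem_connectedComponentIn hx,
      hxy ▸ mem_connectedComponentIn hy,
      Set.subset_compl_iff_disjoint_right.1 (connectedComponentIn_subset _ _)⟩
  have hclos : ∀ x y, x ∉ K → y ∉ K → ¬ JoinedOff K x y →
      y ∉ closure (connectedComponentIn Kᶜ x) := by
    intro x y hx hy hxy hcl
    refine hxy (hdisj x y ?_ hx hy)
    rw [closure_eq_self_union_frontier] at hcl
    rcases hcl with hcl | hcl
    · exact connectedComponentIn_eq hcl
    · exact absurd (frontier_connectedComponentIn_compl_subset hK.isClosed x hcl) hy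
  have hba : ¬ JoinedOff K b a := fun ⟨S, h1, h2, h3, h4⟩ => hnot ⟨S, h1, h3, h2, h4⟩
  -- If one of the two points lies in a bounded component, the frontier of that component lies in
  -- `K` and excludes the logarithm. If neither does, both lie in the unique unbounded component.
  by_cases hbd : Bornology.IsBounded (connectedComponentIn Kᶜ a)
  · exact not_hasLogOn_of_frontier_subset hK.isClosed hbd
      (frontier_connectedComponentIn_compl_subset hK.isClosed a) (mem_connectedComponentIn ha)
      (hclos a b ha hb hnot) h
  · by_cases hbd' : Bornology.IsBounded (connectedComponentIn Kᶜ b)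
    · exact not_hasLogOn_of_frontier_subset hK.isClosed hbd'
        (frontier_connectedComponentIn_compl_subset hK.isClosed b) (mem_connectedComponentIn hb)
        (hclos b a hb ha hba) (h.inv.congr fun z _ => by simp)
    · refine hnot (hdisj a b (connectedComponentIn_eq_of_unbounded ?_ hK.isBounded hbd hbd') ha hb)
      rw [Complex.rank_real_complex]; norm_num

/-- Janiszewski's theorem in the complex plane. -/
theorem JoinedOff.union_complex {A B : Set ℂ} (hA : IsCompact A) (hB : IsCompact B)
    (hAB : IsPreconnected (A ∩ B)) {x y : ℂ} (h1 : JoinedOff A x y) (h2 : JoinedOff B x y) :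
    JoinedOff (A ∪ B) x y := by
  have hx : ∀ {C : Set ℂ}, JoinedOff C x y → x ∉ C ∧ y ∉ C := fun ⟨S, _, hx, hy, hd⟩ =>
    ⟨Set.disjoint_left.1 hd hx, Set.disjoint_left.1 hd hy⟩
  refine HasLogOn.joinedOff (hA.union hB) ?_ ?_
    ((h1.hasLogOn hA.isClosed).union hA.isClosed hB.isClosed hAB (h2.hasLogOn hB.isClosed))
  · exact fun h => h.elim (hx h1).1 (hx h2).1
  · exact fun h => h.elim (hx h1).2 (hx h2).2

theorem joinedOff_arc_complex {γ : unitInterval → ℂ} (hγ : Continuous γ)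
    (hi : Function.Injective γ) {x y : ℂ} (hx : x ∉ range γ) (hy : y ∉ range γ) :
    JoinedOff (range γ) x y := by
  have hne : ∀ w ∉ range γ, ∀ z ∈ range γ, z - w ≠ 0 := fun w hw z hz h0 =>
    hw (sub_eq_zero.1 h0 ▸ hz)
  exact HasLogOn.joinedOff (isCompact_range hγ) hx hy (hasLogOn_arc hγ hi
    (ContinuousOn.div (by fun_prop) (by fun_prop) (hne y hy))
    fun z hz => div_ne_zero (hne x hx z hz) (hne y hy z hz))

theorem Homeomorph.joinedOff_image_iff {E F : Type*} [TopologicalSpace E] [TopologicalSpace F]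
    (e : E ≃ₜ F) {K : Set E} {x y : E} : JoinedOff (e '' K) (e x) (e y) ↔ JoinedOff K x y := by
  constructor
  · rintro ⟨S, hS, hx, hy, hd⟩
    refine ⟨e ⁻¹' S, ?_, hx, hy, ?_⟩
    · rw [← e.image_symm]
      exact hS.image _ e.symm.continuous.continuousOn
    · exact Set.disjoint_left.2 fun z hz hzK => Set.disjoint_left.1 hd hz (mem_image_of_mem e hzK)
  · rintro ⟨S, hS, hx, hy, hd⟩
    exact ⟨e '' S, hS.image _ e.continuous.continuousOn, mem_image_of_mem e hx, mem_image_of_mem e hy,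
      (disjoint_image_iff e.injective).2 hd⟩

namespace PlaneGraph

/-- The Euclidean plane as the complex plane. -/
noncomputable def Plane.toComplex : Plane ≃ₜ ℂ :=
  Complex.orthonormalBasisOneI.repr.symm.toHomeomorph

theorem one_lt_rank_plane : 1 < Module.rank ℝ Plane := by
  rw [← Module.finrank_eq_rank, finrank_euclideanSpace_fin]
  norm_num

/-- Janiszewski's theorem. -/
theorem JoinedOff.union {A B : Set Plane} (hA : IsCompact A) (hB : IsCompact B)
    (hAB : IsPreconnected (A ∩ B)) {x y : Plane} (h1 : JoinedOff A x y) (h2 : JoinedOff B x y) :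
    JoinedOff (A ∪ B) x y := by
  let e := Plane.toComplex
  rw [← e.joinedOff_image_iff] at h1 h2 ⊢
  rw [image_union]
  refine JoinedOff.union_complex (hA.image e.continuous) (hB.image e.continuous) ?_ h1 h2
  rw [← image_inter e.injective]
  exact hAB.image _ e.continuous.continuousOn

/-- An arc does not separate the plane. -/
theorem joinedOff_arc {γ : unitInterval → Plane} (hγ : Continuous γ)
    (hi : Function.Injective γ) {x y : Plane} (hx : x ∉ range γ) (hy : y ∉ range γ) :
    JoinedOff (range γ) x y := by
  let e := Plane.toComplex
  rw [← e.joinedOff_image_iff, ← range_comp]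
  refine joinedOff_arc_complex (e.continuous.comp hγ) (e.injective.comp hi) ?_ ?_
  · rw [range_comp, e.injective.mem_set_image]; exact hx
  · rw [range_comp, e.injective.mem_set_image]; exact hy

end PlaneGraph

/-! ### Tree decompositions and separators -/

namespace PlaneGraph

variable {V : Type*}

/-- `y` can be reached from `x` by a walk of `G` within `W`. -/
def ReachIn (G : SimpleGraph V) (W : Set V) : V → V → Prop :=
  Relation.ReflTransGen fun x y => G.Adj x y ∧ x ∈ W ∧ y ∈ W

/-- Any two vertices of `W` are joined by a walk of `G` within `W`. -/
def ConnIn (G : SimpleGraph V) (W : Set V) : Prop :=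
  ∀ x ∈ W, ∀ y ∈ W, ReachIn G W x y

theorem ReachIn.mono {G : SimpleGraph V} {W W' : Set V} (h : W ⊆ W') {x y : V}
    (hxy : ReachIn G W x y) : ReachIn G W' x y :=
  Relation.ReflTransGen.mono (fun _ _ h' => ⟨h'.1, h h'.2.1, h h'.2.2⟩) _ _ hxy

theorem ReachIn.symm {G : SimpleGraph V} {W : Set V} {x y : V}
    (hxy : ReachIn G W x y) : ReachIn G W y x := by
  induction hxy with
  | refl => exact Relation.ReflTransGen.refl
  | tail _ h ih => exact Relation.ReflTransGen.head ⟨h.1.symm, h.2.2, h.2.1⟩ ih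

theorem ReachIn.mem {G : SimpleGraph V} {W : Set V} {x y : V}
    (hxy : ReachIn G W x y) (hx : x ∈ W) : y ∈ W := by
  induction hxy with
  | refl => exact hx
  | tail _ h ih => exact h.2.2

theorem connIn_of_forall_reachIn {G : SimpleGraph V} {W : Set V} (m : V)
    (h : ∀ x ∈ W, ReachIn G W x m) : ConnIn G W :=
  fun x hx y hy => (h x hx).trans (h y hy).symm

theorem reachIn_of_reachable_induce {G : SimpleGraph V} {W : Set V} {x y : W}
    (h : (G.induce W).Reachable x y) : ReachIn G W x y := by
  rw [SimpleGraph.reachable_iff_reflTransGen] at h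
  exact h.lift Subtype.val fun a b hab => ⟨hab, a.2, b.2⟩

theorem connIn_of_preconnected_induce {G : SimpleGraph V} {W : Set V}
    (h : (G.induce W).Preconnected) : ConnIn G W :=
  fun x hx y hy => reachIn_of_reachable_induce (h ⟨x, hx⟩ ⟨y, hy⟩)

/-- The connected component of `x` in `G[W]`. -/
def compIn (G : SimpleGraph V) (W : Set V) (x : V) : Set V := {y | ReachIn G W x y}

theorem reachIn_compIn {G : SimpleGraph V} {W : Set V} {x y : V} (h : ReachIn G W x y) :
    ReachIn G (compIn G W x) x y := by
  induction h with
  | refl => exact Relation.ReflTransGen.refl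
  | tail h h' ih => exact ih.tail ⟨h'.1, h, h.tail h'⟩

theorem connIn_compIn (G : SimpleGraph V) (W : Set V) (x : V) : ConnIn G (compIn G W x) :=
  connIn_of_forall_reachIn x fun _ hy => (reachIn_compIn hy).symm

theorem compIn_subset {G : SimpleGraph V} {W : Set V} {x : V} (hx : x ∈ W) : compIn G W x ⊆ W :=
  fun _ hy => ReachIn.mem hy hx

section TreeDecomposition

variable {G : SimpleGraph V} {ι : Type} (D : TreeDecomposition G ι)

/-- The nodes whose bags meet `C`. -/
def TreeDecomposition.nodes (C : Set V) : Set ι := {t | ∃ v ∈ D.bag t, v ∈ C}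

variable {D}

theorem TreeDecomposition.reachable_of_mem_bag {s t u u' : ι} {v : V}
    (hv : ¬ (v ∈ D.bag s ∧ v ∈ D.bag t)) (hu : v ∈ D.bag u) (hu' : v ∈ D.bag u') :
    (D.tree.deleteEdges {s(s, t)}).Reachable u u' := by
  have := connIn_of_preconnected_induce (D.connected_nodes v).preconnected u hu u' hu'
  rw [SimpleGraph.reachable_iff_reflTransGen]
  refine Relation.ReflTransGen.mono (fun a b hab => ?_) _ _ this
  rw [SimpleGraph.deleteEdges_adj]
  refine ⟨hab.1, fun h => hv ?_⟩
  rw [mem_singleton_iff, Sym2.eq_iff] at h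
  rcases h with ⟨rfl, rfl⟩ | ⟨rfl, rfl⟩
  · exact hab.2
  · exact hab.2.symm

/-- A vertex outside `bag s ∩ bag t` has a subtree that does not use the edge `st`. Subtrees of
adjacent vertices share a node, so the subtree of all of `W` stays on one side of that edge. -/
theorem TreeDecomposition.reachable_of_connIn {s t u u' : ι} {W : Set V} (hW : ConnIn G W)
    (hv : ∀ v ∈ W, ¬ (v ∈ D.bag s ∧ v ∈ D.bag t)) (hu : u ∈ D.nodes W) (hu' : u' ∈ D.nodes W) :
    (D.tree.deleteEdges {s(s, t)}).Reachable u u' := by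
  obtain ⟨x, hxu, hx⟩ := hu
  obtain ⟨y, hyu, hy⟩ := hu'
  have hxy := hW x hx y hy
  clear hy
  induction hxy generalizing u' with
  | refl => exact reachable_of_mem_bag (hv x hx) hxu hyu
  | tail _ h ih =>
    obtain ⟨w, hw1, hw2⟩ := D.exists_edge_subset_bag _ _ h.1
    exact (ih hw1).trans (reachable_of_mem_bag (hv _ h.2.2) hw2 hyu)

theorem TreeDecomposition.nodes_nonempty {C : Set V} (hC : C.Nonempty) : (D.nodes C).Nonempty := by
  obtain ⟨v, hv⟩ := hC
  obtain ⟨t, ht⟩ := D.exists_mem_bag v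
  exact ⟨t, v, ht, hv⟩

theorem reachable_deleteEdges_of_isPath {T : SimpleGraph ι} {t s u : ι} {h : T.Adj t s}
    {p : T.Walk s u} (hp : (SimpleGraph.Walk.cons h p).IsPath) :
    (T.deleteEdges {s(t, s)}).Reachable s u := by
  rw [SimpleGraph.reachable_deleteEdges_iff_exists_walk]
  rw [SimpleGraph.Walk.cons_isPath_iff] at hp
  exact ⟨p, fun he => hp.2 (p.fst_mem_support_of_mem_edges he)⟩

theorem TreeDecomposition.exists_adj_toward {t : ι} {C : Set V} (hC : ConnIn G C)
    (hne : C.Nonempty) (ht : t ∉ D.nodes C) :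
    ∃ s, D.tree.Adj t s ∧ ∀ u ∈ D.nodes C, (D.tree.deleteEdges {s(t, s)}).Reachable s u := by
  obtain ⟨u, hu⟩ := D.nodes_nonempty hne
  obtain ⟨p, hp⟩ := (D.isTree.connected.preconnected t u).exists_isPath
  cases p with
  | nil => exact absurd hu ht
  | cons h p =>
    refine ⟨_, h, fun u' hu' => (reachable_deleteEdges_of_isPath hp).trans ?_⟩
    exact reachable_of_connIn hC (fun v hv hb => ht ⟨v, hb.1, hv⟩) hu hu'

theorem TreeDecomposition.not_reachable {s t : ι} (h : D.tree.Adj s t) :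
    ¬ (D.tree.deleteEdges {s(s, t)}).Reachable s t :=
  SimpleGraph.isBridge_iff.1
    (SimpleGraph.isAcyclic_iff_forall_adj_isBridge.1 D.isTree.isAcyclic h)

/-- The Helly property of the subtrees that belong to connected sets. -/
theorem TreeDecomposition.exists_mem_nodes_or_disjoint [Finite ι] [Nonempty ι] {κ : Type*}
    {C : κ → Set V} (hC : ∀ i, ConnIn G (C i)) (hne : ∀ i, (C i).Nonempty) :
    (∃ t, ∀ i, t ∈ D.nodes (C i)) ∨ ∃ i j, Disjoint (D.nodes (C i)) (D.nodes (C j)) := by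
  by_contra hcon
  push Not at hcon
  obtain ⟨h1, h2⟩ := hcon
  choose i hi using h1
  choose f hadj hf using fun t => exists_adj_toward (hC (i t)) (hne (i t)) (hi t)
  classical
  have := Fintype.ofFinite ι
  let g : ι → D.tree.edgeSet := fun t => ⟨s(t, f t), hadj t⟩
  have hcard := D.isTree.card_edgeFinset
  rw [SimpleGraph.edgeFinset_card] at hcard
  -- Each node `t` points along an edge towards a subtree that misses it. A tree has fewer edges
  -- than nodes, so two nodes point along the same edge, towards each other, and their subtrees lie
  -- on opposite sides of it.
  obtain ⟨t, t', htt, hg⟩ := Fintype.exists_ne_map_eq_of_card_lt g (by omega)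
  have hg' : s(t, f t) = s(t', f t') := congrArg Subtype.val hg
  rw [Sym2.eq_iff] at hg'
  rcases hg' with ⟨h, -⟩ | ⟨h3, h4⟩
  · exact htt h
  · refine h2 (i t) (i t') (Set.disjoint_left.2 fun u hu hu' => ?_)
    have ha := hf t u hu
    have hb := hf t' u hu'
    rw [h4] at ha
    rw [← h3, Sym2.eq_swap] at hb
    have hadj' := hadj t
    rw [h4] at hadj'
    exact not_reachable hadj' (hb.trans ha.symm)

theorem TreeDecomposition.exists_separator_of_disjoint {k : ℕ}
    (hk : ∀ t, (D.bag t).card ≤ k + 1) {A B : Set V} (hA : ConnIn G A) (hB : ConnIn G B)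
    (hAne : A.Nonempty) (hBne : B.Nonempty) (hAB : Disjoint (D.nodes A) (D.nodes B)) :
    ∃ Y : Finset V, Y.card ≤ k ∧ Disjoint (Y : Set V) A ∧ Disjoint (Y : Set V) B ∧
      ∀ W, ConnIn G W → Disjoint (Y : Set V) W → (W ∩ A).Nonempty → ¬ (W ∩ B).Nonempty := by
  classical
  have hex : ∃ n u u', u ∈ D.nodes A ∧ u' ∈ D.nodes B ∧ D.tree.dist u u' = n := by
    obtain ⟨u, hu⟩ := D.nodes_nonempty hAne
    obtain ⟨u', hu'⟩ := D.nodes_nonempty hBne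
    exact ⟨_, u, u', hu, hu', rfl⟩
  -- For a closest pair of nodes of the two subtrees, the first edge `st` of the path between them
  -- leaves the subtree of `A` at once; the separator is `bag s ∩ bag t`.
  obtain ⟨s, u', hs, hu', hd⟩ := Nat.find_spec hex
  obtain ⟨p, hp, hlen⟩ := D.isTree.connected.exists_path_of_dist s u'
  cases p with
  | nil => exact absurd hu' (Set.disjoint_left.1 hAB hs)
  | @cons _ t _ h p =>
    have htA : t ∉ D.nodes A := by
      intro htA
      refine Nat.find_min hex (m := D.tree.dist t u') ?_ ⟨t, u', htA, hu', rfl⟩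
      have := SimpleGraph.dist_le p
      rw [SimpleGraph.Walk.length_cons] at hlen
      omega
    have hsB : s ∉ D.nodes B := Set.disjoint_left.1 hAB hs
    refine ⟨D.bag s ∩ D.bag t, ?_, ?_, ?_, ?_⟩
    · by_contra hlt
      push Not at hlt
      -- An intersection with more than `k` vertices would be all of `bag s`, so `bag t` would meet
      -- `A` too.
      have h1 : D.bag s ∩ D.bag t = D.bag s :=
        Finset.eq_of_subset_of_card_le Finset.inter_subset_left ((hk s).trans hlt)
      obtain ⟨v, hv, hvA⟩ := hs
      rw [← h1, Finset.mem_inter] at hv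
      exact htA ⟨v, hv.2, hvA⟩
    · exact Set.disjoint_left.2 fun v hv hvA => htA ⟨v, (Finset.mem_inter.1 hv).2, hvA⟩
    · exact Set.disjoint_left.2 fun v hv hvB => hsB ⟨v, (Finset.mem_inter.1 hv).1, hvB⟩
    · rintro W hW hYW ⟨x, hxW, hxA⟩ ⟨y, hyW, hyB⟩
      obtain ⟨a, ha⟩ := D.exists_mem_bag x
      obtain ⟨b, hb⟩ := D.exists_mem_bag y
      have h1 := reachable_of_connIn (s := s) (t := t) hA (fun v hv hb => htA ⟨v, hb.2, hv⟩) hs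
        ⟨x, ha, hxA⟩
      have h2 := reachable_of_connIn (s := s) (t := t) hW (fun v hv hb =>
        Set.disjoint_left.1 hYW (Finset.mem_coe.2 (Finset.mem_inter.2 hb)) hv)
        (u := a) (u' := b) ⟨x, ha, hxW⟩ ⟨y, hb, hyW⟩
      have h3 := reachable_of_connIn (s := s) (t := t) hB (fun v hv hb => hsB ⟨v, hb.1, hv⟩)
        ⟨y, hb, hyB⟩ hu'
      exact not_reachable h (((h1.trans h2).trans h3).trans (reachable_deleteEdges_of_isPath hp).symm)

/-- More than `k + 1` disjoint connected sets: some two of them are separated by `k` vertices. -/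
theorem TreeDecomposition.exists_separator [Finite ι] [Nonempty ι] {k : ℕ}
    (hk : ∀ t, (D.bag t).card ≤ k + 1) {κ : Type*} [Fintype κ] (hκ : k + 1 < Fintype.card κ)
    {C : κ → Set V} (hC : ∀ i, ConnIn G (C i)) (hne : ∀ i, (C i).Nonempty)
    (hdisj : Pairwise fun i j => Disjoint (C i) (C j)) :
    ∃ i j, ∃ Y : Finset V, Y.card ≤ k ∧ Disjoint (Y : Set V) (C i) ∧ Disjoint (Y : Set V) (C j) ∧
      ∀ W, ConnIn G W → Disjoint (Y : Set V) W → (W ∩ C i).Nonempty → ¬ (W ∩ C j).Nonempty := by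
  rcases D.exists_mem_nodes_or_disjoint hC hne with ⟨t, ht⟩ | ⟨i, j, hij⟩
  · exfalso
    choose v hv hvC using ht
    have hinj : Function.Injective v := by
      intro i j hij
      by_contra hne
      exact Set.disjoint_left.1 (hdisj hne) (hvC i) (hij ▸ hvC j)
    have := Finset.card_le_card_of_injOn (s := Finset.univ) (t := D.bag t) v (fun i _ => hv i)
      hinj.injOn
    rw [Finset.card_univ] at this
    have := hk t
    omega
  · exact ⟨i, j, exists_separator_of_disjoint hk (hC i) (hC j) (hne i) (hne j) hij⟩

end TreeDecomposition

/-- A walk between disjoint sets contains an edge between them or has a part that runs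
outside of both. -/
theorem exists_crossing {G : SimpleGraph V} {Z A B : Set V} {x y : V}
    (hxy : ReachIn G Z x y) (hx : x ∈ A) (hy : y ∈ B) (hAB : Disjoint A B) :
    ∃ x' ∈ A ∩ Z, ∃ y' ∈ B ∩ Z, G.Adj x' y' ∨ ∃ m m', m ∈ Z \ (A ∪ B) ∧
      ReachIn G (Z \ (A ∪ B)) m m' ∧ G.Adj x' m ∧ G.Adj m' y' := by
  by_contra hno
  -- Going backwards from the end of the walk, the current vertex is in `B` or starts a stretch
  -- outside `A ∪ B` that ends next to `B`. The first vertex of `A` met on the way back would give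
  -- the crossing.
  have key : x ∈ B ∨ (x ∈ Z \ (A ∪ B) ∧ ∃ m', ReachIn G (Z \ (A ∪ B)) x m' ∧
      ∃ y' ∈ B ∩ Z, G.Adj m' y') := by
    clear hx
    induction hxy using Relation.ReflTransGen.head_induction_on with
    | refl => exact Or.inl hy
    | @head a c h _ ih =>
      obtain ⟨hac, haZ, hcZ⟩ := h
      by_cases haB : a ∈ B
      · exact Or.inl haB
      by_cases haA : a ∈ A
      · exfalso
        rcases ih with hc | ⟨hc, m', hm', y', hy', hadj⟩
        · exact hno ⟨a, ⟨haA, haZ⟩, c, ⟨hc, hcZ⟩, Or.inl hac⟩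
        · exact hno ⟨a, ⟨haA, haZ⟩, y', hy', Or.inr ⟨c, m', hc, hm', hac, hadj⟩⟩
      · have ha : a ∈ Z \ (A ∪ B) := ⟨haZ, fun h => h.elim haA haB⟩
        rcases ih with hc | ⟨hc, m', hm', y', hy', hadj⟩
        · exact Or.inr ⟨ha, a, Relation.ReflTransGen.refl, c, ⟨hc, hcZ⟩, hac⟩
        · exact Or.inr ⟨ha, m', Relation.ReflTransGen.head ⟨hac, ha, hc⟩ hm', y', hy', hadj⟩
  rcases key with h | ⟨h, -⟩
  · exact Set.disjoint_left.1 hAB hx h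
  · exact h.2 (Or.inl hx)

/-- If every connected set that meets `V₁` and `V₂` meets each of `k ≥ 1` disjoint connected sets
outside `V₁ ∪ V₂`, and the treewidth is at most `k`, then `k` vertices separate `V₁` from `V₂`. -/
theorem TreeDecomposition.exists_stronglyDisconnects {G : SimpleGraph V} {ι : Type} [Finite ι]
    [Nonempty ι] (D : TreeDecomposition G ι) {k : ℕ} (hk0 : 0 < k)
    (hk : ∀ t, (D.bag t).card ≤ k + 1) {V₁ V₂ : Set V} (h₁ : ConnIn G V₁) (h₂ : ConnIn G V₂)
    (hne₁ : V₁.Nonempty) (hne₂ : V₂.Nonempty) (h12 : Disjoint V₁ V₂) (C : Fin k → Set V)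
    (hC : ∀ i, ConnIn G (C i)) (hne : ∀ i, (C i).Nonempty)
    (hdisj : Pairwise fun i j => Disjoint (C i) (C j))
    (hd₁ : ∀ i, Disjoint (C i) V₁) (hd₂ : ∀ i, Disjoint (C i) V₂)
    (hsep : ∀ i W, ConnIn G W → (W ∩ V₁).Nonempty → (W ∩ V₂).Nonempty → (W ∩ C i).Nonempty) :
    ∃ Y : Finset V, Y.card ≤ k ∧ StronglyDisconnects G (Y : Set V) V₁ V₂ := by
  classical
  let C' : Option (Option (Fin k)) → Set V := fun o => o.elim V₁ fun o' => o'.elim V₂ C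
  have hC' : ∀ i, ConnIn G (C' i) := by rintro (_ | _ | i); exacts [h₁, h₂, hC i]
  have hne' : ∀ i, (C' i).Nonempty := by rintro (_ | _ | i); exacts [hne₁, hne₂, hne i]
  have hdisj' : Pairwise fun i j => Disjoint (C' i) (C' j) := by
    rintro (_ | _ | i) (_ | _ | j) hij
    · exact absurd rfl hij
    · exact h12
    · exact (hd₁ j).symm
    · exact h12.symm
    · exact absurd rfl hij
    · exact (hd₂ j).symm
    · exact hd₁ i
    · exact hd₂ i
    · exact hdisj fun h => hij (by rw [h])
  have hsep' : ∀ i W, ConnIn G W → (W ∩ V₁).Nonempty → (W ∩ V₂).Nonempty →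
      (W ∩ C' i).Nonempty := by
    rintro (_ | _ | i) W hW hW1 hW2
    exacts [hW1, hW2, hsep i W hW hW1 hW2]
  obtain ⟨i, j, Y₀, hcard, hYi, hYj, hY⟩ := D.exists_separator hk (by simp) hC' hne' hdisj'
  -- The separated pair need not be `V₁` and `V₂`, so `Y₀` may meet these sets; strong separation
  -- requires discarding those vertices.
  refine ⟨Y₀.filter (· ∉ V₁ ∪ V₂), (Finset.card_filter_le _ _).trans hcard, ?_, ?_⟩
  swap
  · ext v
    simp only [Finset.coe_filter, mem_inter_iff, mem_ofPred_eq, mem_empty_iff_false, iff_false]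
    exact fun h => h.1.2 h.2
  rintro ⟨K, ⟨a, ha, ha1⟩, b, hb, hb2⟩
  rw [SimpleGraph.ConnectedComponent.mem_supp_iff] at ha hb
  have hr := reachIn_of_reachable_induce (SimpleGraph.ConnectedComponent.exact (ha.trans hb.symm))
  obtain ⟨x, ⟨hx, -⟩, y, ⟨hy, -⟩, hcase⟩ := exists_crossing hr ha1 hb2 h12
  rcases hcase with hadj | ⟨m, m', hm, hmm, hxm, hmy⟩
  · have hW : ConnIn G {x, y} := by
      refine connIn_of_forall_reachIn x ?_
      rintro z (rfl | rfl)
      · exact Relation.ReflTransGen.refl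
      · exact Relation.ReflTransGen.single ⟨hadj.symm, by simp, by simp⟩
    obtain ⟨z, hz, hzC⟩ := hsep ⟨0, hk0⟩ _ hW ⟨x, by simp, hx⟩ ⟨y, by simp, hy⟩
    rcases hz with rfl | rfl
    · exact Set.disjoint_left.1 (hd₁ _) hzC hx
    · exact Set.disjoint_left.1 (hd₂ _) hzC hy
  · set Z := ((Y₀.filter (· ∉ V₁ ∪ V₂) : Finset V) : Set V)ᶜ \ (V₁ ∪ V₂) with hZ
    have hZY : Z ⊆ (Y₀ : Set V)ᶜ := fun z hz hzY =>
      hz.1 (Finset.mem_coe.2 (Finset.mem_filter.2 ⟨hzY, hz.2⟩))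
    have hMZ : compIn G Z m ⊆ Z := compIn_subset hm
    have hconn : ∀ P : Set V, ConnIn G (compIn G Z m ∪ (P ∩ {x, y})) := by
      intro P
      refine connIn_of_forall_reachIn m ?_
      rintro z (hz | ⟨hzP, rfl | rfl⟩)
      · exact ((reachIn_compIn hz).mono subset_union_left).symm
      · exact Relation.ReflTransGen.single
          ⟨hxm, Or.inr ⟨hzP, Or.inl rfl⟩, Or.inl Relation.ReflTransGen.refl⟩
      · exact Relation.ReflTransGen.head
          ⟨hmy.symm, Or.inr ⟨hzP, Or.inr rfl⟩, Or.inl hmm⟩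
          ((reachIn_compIn hmm).mono subset_union_left).symm
    -- The component of `m` with both ends `x` and `y` attached meets every `C' l`. If `Y₀` misses
    -- `C' l`, a meeting point survives when the ends in `Y₀` are dropped.
    have hmeet : ∀ l, Disjoint (Y₀ : Set V) (C' l) →
        ((compIn G Z m ∪ ((Y₀ : Set V)ᶜ ∩ {x, y})) ∩ C' l).Nonempty := by
      intro l hl
      obtain ⟨z, hz, hzC⟩ := hsep' l _ (hconn univ) ⟨x, Or.inr ⟨trivial, Or.inl rfl⟩, hx⟩
        ⟨y, Or.inr ⟨trivial, Or.inr rfl⟩, hy⟩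
      refine ⟨z, ?_, hzC⟩
      rcases hz with hz | ⟨-, hz⟩
      · exact Or.inl hz
      · exact Or.inr ⟨fun hzY => Set.disjoint_left.1 hl hzY hzC, hz⟩
    refine hY _ (hconn (Y₀ : Set V)ᶜ) ?_ (hmeet i hYi) (hmeet j hYj)
    refine Set.disjoint_left.2 fun z hzY hz => ?_
    rcases hz with hz | hz
    · exact hZY (hMZ hz) hzY
    · exact hz.1 hzY

end PlaneGraph

/-! ### Arcs and drawings of induced subgraphs -/

theorem unitInterval.exists_reparametrization {t : unitInterval} (ht : t < 1) :
    ∃ ρ : unitInterval → unitInterval, Continuous ρ ∧ Function.Injective ρ ∧ range ρ = Ici t := by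
  have ht' : (t : ℝ) < 1 := ht
  have hpos : 0 < 1 - (t : ℝ) := by linarith
  have hmem : ∀ s : unitInterval, (t : ℝ) + s * (1 - t) ∈ unitInterval := fun s => by
    have h1 := mul_nonneg s.2.1 hpos.le
    have h2 := mul_le_mul_of_nonneg_right s.2.2 hpos.le
    have := t.2.1
    constructor <;> linarith
  refine ⟨fun s => ⟨_, hmem s⟩, by fun_prop, ?_, ?_⟩
  · intro s s' h
    have h' : (t : ℝ) + s * (1 - t) = t + s' * (1 - t) := congrArg Subtype.val h
    exact Subtype.ext (mul_right_cancel₀ hpos.ne' (add_left_cancel h'))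
  · ext r
    constructor
    · rintro ⟨s, rfl⟩
      have := mul_nonneg s.2.1 hpos.le
      exact (le_add_of_nonneg_right this : (t : ℝ) ≤ t + s * (1 - t))
    · intro hr
      have hr' : (t : ℝ) ≤ r := hr
      have hr1 : (r : ℝ) ≤ 1 := r.2.2
      refine ⟨⟨(r - t) / (1 - t), div_nonneg (by linarith) hpos.le,
        (div_le_one hpos).2 (by linarith)⟩, Subtype.ext ?_⟩
      simp only
      field_simp
      ring

namespace PlaneGraph

theorem IsArc.isCompact {x y : Plane} {A : Set Plane} (h : IsArc x y A) : IsCompact A := by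
  obtain ⟨γ, hc, -, -, -, rfl⟩ := h
  exact isCompact_range hc

theorem IsArc.isPreconnected {x y : Plane} {A : Set Plane} (h : IsArc x y A) :
    IsPreconnected A := by
  obtain ⟨γ, hc, -, -, -, rfl⟩ := h
  exact isPreconnected_range hc

theorem IsArc.left_mem {x y : Plane} {A : Set Plane} (h : IsArc x y A) : x ∈ A := by
  obtain ⟨γ, -, -, rfl, -, rfl⟩ := h
  exact mem_range_self _

theorem IsArc.right_mem {x y : Plane} {A : Set Plane} (h : IsArc x y A) : y ∈ A := by
  obtain ⟨γ, -, -, -, rfl, rfl⟩ := h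
  exact mem_range_self _

namespace PlanarEmbedding

variable {V : Type*} {G : SimpleGraph V} (φ : PlanarEmbedding G)

theorem isCompact_arc (e : G.edgeSet) : IsCompact (φ.arc e) := by
  obtain ⟨e, he⟩ := e
  induction e with
  | _ u v => exact (φ.isArc_arc u v he).isCompact

theorem mem_drawing {S : Set V} {x : Plane} : x ∈ φ.drawing S ↔
    (∃ v ∈ S, φ.pos v = x) ∨ ∃ e : G.edgeSet, (∀ w ∈ (e : Sym2 V), w ∈ S) ∧ x ∈ φ.arc e := by
  simp only [drawing, mem_union, mem_image, mem_iUnion, exists_prop]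

theorem pos_mem_drawing {S : Set V} {v : V} (hv : v ∈ S) : φ.pos v ∈ φ.drawing S :=
  φ.mem_drawing.2 (Or.inl ⟨v, hv, rfl⟩)

theorem arc_subset_drawing {S : Set V} {e : G.edgeSet} (he : ∀ w ∈ (e : Sym2 V), w ∈ S) :
    φ.arc e ⊆ φ.drawing S :=
  fun _ hx => φ.mem_drawing.2 (Or.inr ⟨e, he, hx⟩)

theorem drawing_mono {S T : Set V} (h : S ⊆ T) : φ.drawing S ⊆ φ.drawing T := by
  intro x hx
  rw [mem_drawing] at hx ⊢
  rcases hx with ⟨v, hv, rfl⟩ | ⟨e, he, hx⟩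
  · exact Or.inl ⟨v, h hv, rfl⟩
  · exact Or.inr ⟨e, fun w hw => h (he w hw), hx⟩

theorem disjoint_drawing {S T : Set V} (h : Disjoint S T) :
    Disjoint (φ.drawing S) (φ.drawing T) := by
  rw [Set.disjoint_left] at h ⊢
  intro x hx hx'
  rw [mem_drawing] at hx hx'
  rcases hx with ⟨v, hv, rfl⟩ | ⟨e, he, hx⟩ <;> rcases hx' with ⟨w, hw, hx'⟩ | ⟨f, hf, hx'⟩
  · exact h hv (φ.pos_injective hx' ▸ hw)
  · exact h hv (hf v (φ.mem_of_pos_mem_arc v f hx'))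
  · subst hx'
    exact h (he w (φ.mem_of_pos_mem_arc w e hx)) hw
  · by_cases hef : e = f
    · subst hef
      have hm := Sym2.out_fst_mem (e : Sym2 V)
      exact h (he _ hm) (hf _ hm)
    · obtain ⟨w, hw, hw', -⟩ := φ.arc_inter_arc e f hef x ⟨hx, hx'⟩
      exact h (he w hw) (hf w hw')

theorem isCompact_drawing [Finite V] (S : Set V) : IsCompact (φ.drawing S) := by
  have : Finite G.edgeSet := Subtype.finite
  exact ((toFinite S).image _).isCompact.union
    (isCompact_iUnion fun e => isCompact_iUnion fun _ => φ.isCompact_arc e)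

theorem isPreconnected_drawing {W : Set V} (hW : ConnIn G W) :
    IsPreconnected (φ.drawing W) := by
  rcases W.eq_empty_or_nonempty with rfl | ⟨w₀, hw₀⟩
  · have : φ.drawing ∅ = ∅ := by
      refine eq_empty_of_forall_notMem fun x hx => ?_
      exact Set.disjoint_left.1 (φ.disjoint_drawing (disjoint_empty (∅ : Set V))) hx hx
    rw [this]
    exact isPreconnected_empty
  have key : ∀ w ∈ W, ∃ t ⊆ φ.drawing W, φ.pos w₀ ∈ t ∧ φ.pos w ∈ t ∧ IsPreconnected t := by
    intro w hw
    have hr := hW w₀ hw₀ w hw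
    clear hw
    induction hr with
    | refl => exact ⟨{φ.pos w₀}, singleton_subset_iff.2 (φ.pos_mem_drawing hw₀), rfl, rfl,
        isPreconnected_singleton⟩
    | @tail b c _ h ih =>
      obtain ⟨t, ht, h1, h2, h3⟩ := ih
      have harc := φ.isArc_arc b c h.1
      refine ⟨t ∪ φ.arc ⟨s(b, c), h.1⟩, union_subset ht (φ.arc_subset_drawing ?_), Or.inl h1,
        Or.inr harc.right_mem, h3.union _ h2 harc.left_mem harc.isPreconnected⟩
      rintro z hz
      rcases Sym2.mem_iff.1 hz with rfl | rfl
      exacts [h.2.1, h.2.2]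
  refine isPreconnected_of_forall (φ.pos w₀) fun x hx => ?_
  rcases φ.mem_drawing.1 hx with ⟨v, hv, rfl⟩ | ⟨⟨e, he⟩, heW, hx⟩
  · exact key v hv
  · induction e with
    | _ u v =>
      obtain ⟨t, ht, h1, h2, h3⟩ := key u (heW u (Sym2.mem_mk_left u v))
      have harc := φ.isArc_arc u v he
      exact ⟨t ∪ φ.arc ⟨s(u, v), he⟩, union_subset ht (φ.arc_subset_drawing heW), Or.inl h1,
        Or.inr hx, h3.union _ h2 harc.left_mem harc.isPreconnected⟩

/-! ### The outer face and the coast -/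

section OuterFace

theorem disjoint_outerFace_drawing (S : Set V) : Disjoint (φ.outerFace S) (φ.drawing S) :=
  Set.disjoint_left.2 fun _ hx => hx.1

theorem outerFace_antitone {S T : Set V} (h : S ⊆ T) : φ.outerFace T ⊆ φ.outerFace S := by
  have hc := compl_subset_compl.2 (φ.drawing_mono h)
  exact fun x hx => ⟨hc hx.1, fun hb => hx.2 (hb.subset (connectedComponentIn_mono x hc))⟩

theorem mem_coast_iff {S : Set V} {v : V} :
    v ∈ φ.coast S ↔ v ∈ S ∧ φ.pos v ∈ closure (φ.outerFace S) := by
  refine and_congr_right fun hv => ⟨fun h => h.1, fun h => ⟨h, fun hi => ?_⟩⟩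
  exact Set.disjoint_left.1 (φ.disjoint_outerFace_drawing S) (interior_subset hi)
    (φ.pos_mem_drawing hv)

theorem coast_subset (S : Set V) : φ.coast S ⊆ S := fun _ hv => hv.1

theorem drawing_union_of_no_adj {S A : Set V} (hA : A ⊆ S)
    (hadj : ∀ a ∈ A, ∀ b ∈ S, G.Adj a b → b ∈ A) :
    φ.drawing A ∪ φ.drawing (S \ A) = φ.drawing S := by
  refine (union_subset (φ.drawing_mono hA) (φ.drawing_mono sdiff_subset)).antisymm ?_
  intro x hx
  rcases φ.mem_drawing.1 hx with ⟨v, hv, rfl⟩ | ⟨⟨e, he⟩, heS, hx⟩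
  · by_cases hvA : v ∈ A
    · exact Or.inl (φ.pos_mem_drawing hvA)
    · exact Or.inr (φ.pos_mem_drawing ⟨hv, hvA⟩)
  · induction e with
    | _ u v =>
      have hu := heS u (Sym2.mem_mk_left u v)
      have hv := heS v (Sym2.mem_mk_right u v)
      by_cases huA : u ∈ A
      · refine Or.inl (φ.arc_subset_drawing ?_ hx)
        intro w hw
        rcases Sym2.mem_iff.1 hw with rfl | rfl
        exacts [huA, hadj u huA _ hv he]
      · refine Or.inr (φ.arc_subset_drawing ?_ hx)
        intro w hw
        rcases Sym2.mem_iff.1 hw with rfl | rfl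
        exacts [⟨hu, huA⟩, ⟨hv, fun hvA => huA (hadj _ hvA _ hu he.symm)⟩]

variable [Finite V]

theorem outerFace_eq {S : Set V} {x : Plane} (hx : x ∈ φ.outerFace S) :
    φ.outerFace S = connectedComponentIn (φ.drawing S)ᶜ x := by
  ext y
  constructor
  · intro hy
    rw [connectedComponentIn_eq_of_unbounded one_lt_rank_plane (φ.isCompact_drawing S).isBounded
      hx.2 hy.2]
    exact mem_connectedComponentIn hy.1
  · intro hy
    refine ⟨connectedComponentIn_subset _ _ hy, ?_⟩
    rw [← connectedComponentIn_eq hy]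
    exact hx.2

theorem isPreconnected_outerFace (S : Set V) : IsPreconnected (φ.outerFace S) := by
  rcases (φ.outerFace S).eq_empty_or_nonempty with h | ⟨x, hx⟩
  · rw [h]; exact isPreconnected_empty
  · rw [φ.outerFace_eq hx]; exact isPreconnected_connectedComponentIn

theorem frontier_outerFace_subset_drawing (S : Set V) :
    frontier (φ.outerFace S) ⊆ φ.drawing S := by
  rcases (φ.outerFace S).eq_empty_or_nonempty with h | ⟨x, hx⟩
  · rw [h, frontier_empty]; exact empty_subset _
  · rw [φ.outerFace_eq hx]
    exact frontier_connectedComponentIn_compl_subset (φ.isCompact_drawing S).isClosed x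

theorem mem_outerFace_of_mem_closure {S : Set V} {x : Plane} (hx : x ∈ closure (φ.outerFace S))
    (hxS : x ∉ φ.drawing S) : x ∈ φ.outerFace S := by
  rw [closure_eq_self_union_frontier] at hx
  exact hx.resolve_right fun h => hxS (φ.frontier_outerFace_subset_drawing S h)

theorem subset_outerFace {S : Set V} {Q : Set Plane} (hQ : IsPreconnected Q)
    (hQS : Disjoint Q (φ.drawing S)) {x : Plane} (hxQ : x ∈ Q) (hx : x ∈ φ.outerFace S) :
    Q ⊆ φ.outerFace S := by
  rw [φ.outerFace_eq hx]
  exact hQ.subset_connectedComponentIn hxQ (subset_compl_iff_disjoint_right.2 hQS)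

/-- If the outer face touches an inner point of an edge, then it touches the ends of the edge. -/
theorem pos_mem_closure_outerFace {R : Set V} {u v : V} (huv : G.Adj u v) (hu : u ∈ R)
    (hv : v ∈ R) {p : Plane} (hp : p ∈ φ.arc ⟨s(u, v), huv⟩) (hpv : p ≠ φ.pos v)
    (hpF : p ∈ closure (φ.outerFace R)) : φ.pos u ∈ closure (φ.outerFace R) := by
  by_contra hnot
  have : Finite G.edgeSet := Subtype.finite
  set F := φ.outerFace R with hF
  set e : G.edgeSet := ⟨s(u, v), huv⟩ with he
  have heR : ∀ w ∈ (e : Sym2 V), w ∈ R := by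
    intro w hw
    rcases Sym2.mem_iff.1 hw with rfl | rfl
    exacts [hu, hv]
  obtain ⟨γ, hγ, hinj, hγ0, hγ1, hrange⟩ := φ.isArc_arc u v huv
  have hrange' : range γ = φ.arc e := hrange
  have hFD := Set.disjoint_left.1 (φ.disjoint_outerFace_drawing R)
  have hγD : ∀ t, γ t ∈ φ.drawing R := fun t =>
    φ.arc_subset_drawing heR (hrange' ▸ mem_range_self t)
  -- the first parameter at which the arc touches the closure of the outer face
  obtain ⟨s, hs⟩ : p ∈ range γ := hrange' ▸ hp
  obtain ⟨t₀, ht₀F, ht₀⟩ := ((isClosed_closure (s := F)).preimage hγ).isCompact.exists_isLeast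
    ⟨s, show γ s ∈ closure F from hs ▸ hpF⟩
  have ht₀pos : 0 < t₀ := by
    refine lt_of_le_of_ne unitInterval.nonneg' fun h => hnot ?_
    rw [← hγ0, h]; exact ht₀F
  have ht₀lt : t₀ < 1 := by
    refine (ht₀ (show γ s ∈ closure F from hs ▸ hpF)).trans_lt
      (lt_of_le_of_ne unitInterval.le_one' fun h => hpv ?_)
    rw [← hs, h, hγ1]
  obtain ⟨t₁, h1pos, h1lt⟩ := exists_between ht₀pos
  obtain ⟨t₂, h2pos, h2lt⟩ := exists_between h1pos
  -- the drawing without the inner points of the edge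
  let D : Set Plane := φ.pos '' R ∪
    ⋃ (f : G.edgeSet) (_ : (∀ w ∈ (f : Sym2 V), w ∈ R) ∧ f ≠ e), φ.arc f
  have hDc : IsCompact D := ((toFinite R).image _).isCompact.union
    (isCompact_iUnion fun f => isCompact_iUnion fun _ => φ.isCompact_arc f)
  have hDsub : D ⊆ φ.drawing R := by
    rintro x (⟨w, hw, rfl⟩ | hx)
    · exact φ.pos_mem_drawing hw
    · obtain ⟨f, hf, hx⟩ := mem_iUnion₂.1 hx
      exact φ.arc_subset_drawing hf.1 hx
  have hcover : ∀ x ∈ φ.drawing R, x ∈ D ∨ x ∈ range γ := by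
    intro x hx
    rcases φ.mem_drawing.1 hx with ⟨w, hw, rfl⟩ | ⟨f, hf, hx⟩
    · exact Or.inl (Or.inl ⟨w, hw, rfl⟩)
    · by_cases hfe : f = e
      · subst hfe; exact Or.inr (hrange' ▸ hx)
      · exact Or.inl (Or.inr (mem_iUnion₂.2 ⟨f, ⟨hf, hfe⟩, hx⟩))
  have hends : ∀ t, γ t ∈ D → t = 0 ∨ t = 1 := by
    intro t ht
    have hte : γ t ∈ φ.arc e := hrange' ▸ mem_range_self t
    have hcommon : ∃ w ∈ (e : Sym2 V), γ t = φ.pos w := by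
      rcases ht with ⟨w, hw, hwt⟩ | ht
      · exact ⟨w, φ.mem_of_pos_mem_arc w e (hwt ▸ hte), hwt.symm⟩
      · obtain ⟨f, hf, hx⟩ := mem_iUnion₂.1 ht
        obtain ⟨w, -, hw, hwt⟩ := φ.arc_inter_arc f e hf.2 _ ⟨hx, hte⟩
        exact ⟨w, hw, hwt⟩
    obtain ⟨w, hw, hwt⟩ := hcommon
    rcases Sym2.mem_iff.1 hw with rfl | rfl
    · exact Or.inl (hinj (hwt.trans hγ0.symm))
    · exact Or.inr (hinj (hwt.trans hγ1.symm))
  obtain ⟨ρ, hρ, hρi, hρr⟩ := unitInterval.exists_reparametrization (h1lt.trans ht₀lt)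
  have hB : range (γ ∘ ρ) = γ '' Ici t₁ := by rw [range_comp, hρr]
  obtain ⟨ε, hε, hball⟩ := Metric.mem_nhds_iff.1 (hDc.isClosed.isOpen_compl.mem_nhds
    (show γ t₀ ∈ Dᶜ from fun h => (hends _ h).elim ht₀pos.ne' ht₀lt.ne))
  obtain ⟨q, hqb, hqF⟩ := mem_closure_iff.1 ht₀F _ Metric.isOpen_ball
    (Metric.mem_ball_self hε)
  -- Without the inner points of this edge, one can run along the arc from `γ t₂` to `γ t₀` and then
  -- through a small ball to the point `q` of the outer face.
  have hj1 : JoinedOff D (γ t₂) q := by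
    refine ⟨γ '' Icc t₂ t₀ ∪ Metric.ball (γ t₀) ε, ?_,
      Or.inl ⟨t₂, ⟨le_rfl, (h2lt.trans h1lt).le⟩, rfl⟩, Or.inr hqb, ?_⟩
    · exact (isPreconnected_Icc.image _ hγ.continuousOn).union (γ t₀)
        ⟨t₀, ⟨(h2lt.trans h1lt).le, le_rfl⟩, rfl⟩ (Metric.mem_ball_self hε)
        (convex_ball _ _).isPreconnected
    · refine Set.disjoint_left.2 ?_
      rintro _ (⟨t, ht, rfl⟩ | hx) hxD
      · exact (hends _ hxD).elim (h2pos.trans_le ht.1).ne' (ht.2.trans_lt ht₀lt).ne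
      · exact hball hx hxD
  have hj2 : JoinedOff (range (γ ∘ ρ)) (γ t₂) q := by
    refine joinedOff_arc (hγ.comp hρ) (hinj.comp hρi) ?_ ?_
    · rw [hB, hinj.mem_set_image]
      exact not_le.2 h2lt
    · rintro ⟨t, rfl⟩
      exact hFD hqF (hγD _)
  -- The rest of the drawing and the final piece of the arc share at most the end `γ 1`, so
  -- Janiszewski's theorem applies.
  have hpre : IsPreconnected (D ∩ range (γ ∘ ρ)) := by
    refine Set.Subsingleton.isPreconnected fun x hx y hy => ?_
    have : ∀ z ∈ D ∩ range (γ ∘ ρ), z = γ 1 := by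
      rintro z ⟨hzD, hz⟩
      rw [hB] at hz
      obtain ⟨t, ht, rfl⟩ := hz
      rw [(hends t hzD).resolve_left (h1pos.trans_le ht).ne']
    rw [this x hx, this y hy]
  obtain ⟨S, hS, hxS, hqS, hSd⟩ := JoinedOff.union hDc (isCompact_range (hγ.comp hρ)) hpre hj1 hj2
  -- The joining set must cross the frontier of the outer face, and it can do so only at some `γ t`
  -- with `t < t₁`, before the first touching parameter `t₀`.
  obtain ⟨z, hzS, hzF⟩ := hS.inter_frontier_nonempty (F := F) ⟨q, hqS, hqF⟩ hxS
    fun h => hFD h (hγD _)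
  have hzn := Set.disjoint_left.1 hSd hzS
  rcases hcover z (φ.frontier_outerFace_subset_drawing R hzF) with hz | ⟨t, rfl⟩
  · exact hzn (Or.inl hz)
  · have htt : t < t₁ := by
      by_contra h
      exact hzn (Or.inr (hB ▸ mem_image_of_mem γ (not_lt.1 h)))
    exact absurd (ht₀ (show γ t ∈ closure F from hzF.1)) (not_le.2 (htt.trans h1lt))

theorem frontier_outerFace_subset_drawing_coast (R : Set V) :
    frontier (φ.outerFace R) ⊆ φ.drawing (φ.coast R) := by
  intro p hp
  rcases φ.mem_drawing.1 (φ.frontier_outerFace_subset_drawing R hp) with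
    ⟨v, hv, rfl⟩ | ⟨⟨e, he⟩, heR, hpe⟩
  · exact φ.pos_mem_drawing ⟨hv, hp⟩
  · induction e with
    | _ u v =>
      have hu := heR u (Sym2.mem_mk_left u v)
      have hv := heR v (Sym2.mem_mk_right u v)
      by_cases hpu : p = φ.pos u
      · subst hpu; exact φ.pos_mem_drawing ⟨hu, hp⟩
      by_cases hpv : p = φ.pos v
      · subst hpv; exact φ.pos_mem_drawing ⟨hv, hp⟩
      have h1 := φ.pos_mem_closure_outerFace he hu hv hpe hpv hp.1
      have hswap : (⟨s(u, v), he⟩ : G.edgeSet) = ⟨s(v, u), he.symm⟩ :=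
        Subtype.ext Sym2.eq_swap
      have h2 := φ.pos_mem_closure_outerFace he.symm hv hu (hswap ▸ hpe) hpu hp.1
      refine φ.arc_subset_drawing ?_ hpe
      intro w hw
      rcases Sym2.mem_iff.1 hw with rfl | rfl
      · exact φ.mem_coast_iff.2 ⟨hu, h1⟩
      · exact φ.mem_coast_iff.2 ⟨hv, h2⟩

/-- The arc without its end at `y` misses the drawing of `R`, so it stays in the outer face and has
`y` as a limit point. -/
theorem mem_coast_of_adj {R : Set V} {y w : V} (h : G.Adj y w) (hy : y ∈ R) (hw : w ∉ R)
    (hwF : φ.pos w ∈ φ.outerFace R) : y ∈ φ.coast R := by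
  obtain ⟨γ, hγ, hinj, hγ0, hγ1, hrange⟩ := φ.isArc_arc y w h
  set e : G.edgeSet := ⟨s(y, w), h⟩ with he
  have hsub : γ '' Ioi 0 ⊆ φ.outerFace R := by
    refine φ.subset_outerFace (isPreconnected_Ioi.image _ hγ.continuousOn) ?_
      ⟨1, (zero_lt_one : (0 : unitInterval) < 1), hγ1⟩ hwF
    refine Set.disjoint_left.2 ?_
    rintro _ ⟨t, ht, rfl⟩ htD
    have hte : γ t ∈ φ.arc e := hrange ▸ mem_range_self t
    have hcommon : ∃ v ∈ R, v ∈ (e : Sym2 V) ∧ γ t = φ.pos v := by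
      rcases φ.mem_drawing.1 htD with ⟨v, hv, hvt⟩ | ⟨f, hf, hx⟩
      · exact ⟨v, hv, φ.mem_of_pos_mem_arc v e (hvt ▸ hte), hvt.symm⟩
      · have hfe : f ≠ e := by
          rintro rfl
          exact hw (hf w (Sym2.mem_mk_right y w))
        obtain ⟨v, hvf, hve, hvt⟩ := φ.arc_inter_arc f e hfe _ ⟨hx, hte⟩
        exact ⟨v, hf v hvf, hve, hvt⟩
    obtain ⟨v, hvR, hve, hvt⟩ := hcommon
    rcases Sym2.mem_iff.1 hve with rfl | rfl
    · exact (ne_of_gt ht) (hinj (hvt.trans hγ0.symm))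
    · exact hw hvR
  refine φ.mem_coast_iff.2 ⟨hy, ?_⟩
  have hcl : closure (Ioi (0 : unitInterval)) ⊆ γ ⁻¹' closure (φ.outerFace R) :=
    closure_minimal (fun t ht => subset_closure (hsub ⟨t, ht, rfl⟩))
      (isClosed_closure.preimage hγ)
  rw [closure_Ioi' (a := (0 : unitInterval)) ⟨1, (zero_lt_one : (0 : unitInterval) < 1)⟩] at hcl
  rw [← hγ0]
  exact hcl (le_refl (0 : unitInterval))

/-- A coast vertex is in the closure of the outer face; once deleted it is off the drawing and hence
inside the new outer face. Outer faces only grow afterwards. -/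
theorem pos_mem_outerFace_remaining (i : ℕ) {w : V} (hw : w ∉ φ.remaining i) :
    φ.pos w ∈ φ.outerFace (φ.remaining i) := by
  induction i with
  | zero => exact absurd (mem_univ w) hw
  | succ i ih =>
    have hsub : φ.remaining (i + 1) ⊆ φ.remaining i := sdiff_subset
    by_cases hwi : w ∈ φ.remaining i
    · have hwc : w ∈ φ.coast (φ.remaining i) := by
        by_contra h
        exact hw ⟨hwi, h⟩
      refine φ.mem_outerFace_of_mem_closure
        (closure_mono (φ.outerFace_antitone hsub) (φ.mem_coast_iff.1 hwc).2) fun h => ?_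
      exact Set.disjoint_left.1 (φ.disjoint_drawing (disjoint_singleton_left.2 hw))
        (φ.pos_mem_drawing (mem_singleton w)) h
    · exact φ.outerFace_antitone hsub (ih hwi)

/-- A connected set next to a coast vertex outside of `A` is not separated from the outer face by
the drawing of `A`. -/
theorem joinedOff_drawing {R A K : Set V} (hA : A ⊆ φ.coast R) (hK : ConnIn G K)
    (hKR : K ⊆ R \ φ.coast R) {v x y : V} (hv : v ∈ φ.coast R) (hvA : v ∉ A) (hx : x ∈ K)
    (hy : y ∈ K) (hvy : G.Adj v y) {b : Plane} (hb : b ∈ φ.outerFace R) :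
    JoinedOff (φ.drawing A) (φ.pos x) b := by
  have hconn : ConnIn G (insert v K) := by
    refine connIn_of_forall_reachIn y ?_
    rintro z (rfl | hz)
    · exact Relation.ReflTransGen.single ⟨hvy, mem_insert _ _, mem_insert_of_mem _ hy⟩
    · exact (hK z hz y hy).mono (subset_insert _ _)
  have hF : IsPreconnected (insert (φ.pos v) (φ.outerFace R)) :=
    (φ.isPreconnected_outerFace R).subset_closure (subset_insert _ _)
      (insert_subset (φ.mem_coast_iff.1 hv).2 subset_closure)
  have hAv : Disjoint (insert v K) A := by
    refine Set.disjoint_left.2 ?_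
    rintro z (rfl | hz) hzA
    · exact hvA hzA
    · exact (hKR hz).2 (hA hzA)
  have hd := Set.disjoint_left.1 (φ.disjoint_drawing hAv)
  -- The joining set passes from `K` to the outer face through the coast vertex `v`.
  refine ⟨_, (φ.isPreconnected_drawing hconn).union (φ.pos v)
    (φ.pos_mem_drawing (mem_insert _ _)) (mem_insert _ _) hF,
    Or.inl (φ.pos_mem_drawing (mem_insert_of_mem _ hx)), Or.inr (mem_insert_of_mem _ hb), ?_⟩
  refine Set.disjoint_left.2 ?_
  rintro z (hz | rfl | hz) hzA
  · exact hd hz hzA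
  · exact hd (φ.pos_mem_drawing (mem_insert _ _)) hzA
  · exact Set.disjoint_left.1 (φ.disjoint_outerFace_drawing R) hz
      (φ.drawing_mono (hA.trans (φ.coast_subset R)) hzA)

/-- The coast vertices next to a connected set off the coast lie in one component of the coast. -/
theorem reachIn_coast {R K : Set V} (hK : ConnIn G K) (hKR : K ⊆ R \ φ.coast R) {u v x y : V}
    (hu : u ∈ φ.coast R) (hv : v ∈ φ.coast R) (hx : x ∈ K) (hy : y ∈ K) (hux : G.Adj u x)
    (hvy : G.Adj v y) : ReachIn G (φ.coast R) u v := by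
  by_contra hnot
  set A := compIn G (φ.coast R) u with hAdef
  have hA : A ⊆ φ.coast R := compIn_subset hu
  have huA : u ∈ A := Relation.ReflTransGen.refl
  obtain ⟨b, hb⟩ : (φ.outerFace R).Nonempty :=
    closure_nonempty_iff.1 ⟨_, (φ.mem_coast_iff.1 hu).2⟩
  have h1 := φ.joinedOff_drawing hA hK hKR hv hnot hx hy hvy hb
  have h2 := φ.joinedOff_drawing (A := φ.coast R \ A) sdiff_subset hK hKR hu (fun h => h.2 huA)
    hx hx hux hb
  obtain ⟨S, hS, hxS, hbS, hSd⟩ := JoinedOff.union (φ.isCompact_drawing _)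
    (φ.isCompact_drawing _) (by
      rw [(φ.disjoint_drawing disjoint_sdiff_right).inter_eq]
      exact isPreconnected_empty) h1 h2
  rw [φ.drawing_union_of_no_adj hA fun a ha c hc hac => ha.tail ⟨hac, hA ha, hc⟩] at hSd
  obtain ⟨z, hzS, hzF⟩ := hS.inter_frontier_nonempty (F := φ.outerFace R) ⟨b, hbS, hb⟩ hxS
    fun h => Set.disjoint_left.1 (φ.disjoint_outerFace_drawing R) h (φ.pos_mem_drawing (hKR hx).1)
  exact Set.disjoint_left.1 hSd hzS (φ.frontier_outerFace_subset_drawing_coast R hzF)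

/-- If some connected set meets `V₁` and `V₂`, then a connected part of the coast separates a
connected set `V₂` strictly inside the coast from a set `V₁` of removed vertices. -/
theorem exists_separating_coast_part {R V₁ V₂ W₀ : Set V}
    (hout : ∀ w ∉ R, φ.pos w ∈ φ.outerFace R) (h₂ : ConnIn G V₂) (hV₂ : V₂ ⊆ R \ φ.coast R)
    (hV₁ : Disjoint V₁ R) (hW₀ : ConnIn G W₀) (hW₁ : (W₀ ∩ V₁).Nonempty)
    (hW₂ : (W₀ ∩ V₂).Nonempty) :
    ∃ C ⊆ φ.coast R, ConnIn G C ∧ C.Nonempty ∧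
      ∀ W, ConnIn G W → (W ∩ V₁).Nonempty → (W ∩ V₂).Nonempty → (W ∩ C).Nonempty := by
  obtain ⟨x₂, -, hx₂⟩ := id hW₂
  set K := compIn G (R \ φ.coast R) x₂ with hKdef
  have hKR : K ⊆ R \ φ.coast R := compIn_subset (hV₂ hx₂)
  have hK : ConnIn G K := connIn_compIn _ _ _
  have hV₂K : V₂ ⊆ K := fun z hz => (h₂ x₂ hx₂ z hz).mono hV₂
  -- A walk from `V₂` to `V₁` must leave `K`. It cannot step directly out of `R`, because a vertex
  -- of `R` adjacent to a removed vertex is on the coast; so its first step out of `K` ends on the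
  -- coast.
  have hexit : ∀ W, ConnIn G W → (W ∩ V₁).Nonempty → (W ∩ V₂).Nonempty →
      ∃ c ∈ W, c ∈ φ.coast R ∧ ∃ y ∈ K, G.Adj c y := by
    rintro W hW ⟨a, haW, ha⟩ ⟨b, hbW, hb⟩
    by_contra hno
    have hr := hW b hbW a haW
    have : a ∈ K := by
      clear ha haW
      induction hr with
      | refl => exact hV₂K hb
      | @tail c d _ h ih =>
        have hc := hKR ih
        have hdR : d ∈ R := by
          by_contra hd
          exact hc.2 (φ.mem_coast_of_adj h.1 hc.1 hd (hout d hd))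
        by_cases hdc : d ∈ φ.coast R
        · exact absurd ⟨d, h.2.2, hdc, c, ih, h.1.symm⟩ hno
        · exact Relation.ReflTransGen.tail ih ⟨h.1, hc, hdR, hdc⟩
    exact Set.disjoint_left.1 hV₁ ha (hKR this).1
  obtain ⟨u, -, hu, x, hx, hux⟩ := hexit W₀ hW₀ hW₁ hW₂
  refine ⟨compIn G (φ.coast R) u, compIn_subset hu, connIn_compIn _ _ _,
    ⟨u, Relation.ReflTransGen.refl⟩, fun W hW h1 h2 => ?_⟩
  obtain ⟨v, hvW, hv, y, hy, hvy⟩ := hexit W hW h1 h2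
  exact ⟨v, hvW, φ.reachIn_coast hK hKR hu hv hx hy hux hvy⟩

end OuterFace

/-! ### Heights, and the proof of the theorem -/

theorem remaining_antitone : Antitone φ.remaining :=
  antitone_nat_of_succ_le fun _ => sdiff_subset

theorem notMem_remaining_of_height_le {v : V} {a : ℕ} (h : φ.height v ≤ a) :
    v ∉ φ.remaining a := by
  intro hv
  have : ((a + 1 : ℕ) : ℕ∞) ≤ φ.height v := by
    refine le_iInf₂ fun i hi => ?_
    rw [Nat.cast_le]
    by_contra hlt
    exact hi (φ.remaining_antitone (by omega) hv)
  have := this.trans h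
  rw [Nat.cast_le] at this
  omega

theorem mem_remaining_of_lt_height {v : V} {i : ℕ} (h : (i : ℕ∞) < φ.height v) :
    v ∈ φ.remaining i := by
  by_contra hv
  exact absurd (iInf₂_le i hv) (not_le.2 h)

theorem disjoint_coast_remaining {i j : ℕ} (h : i < j) :
    Disjoint (φ.coast (φ.remaining i)) (φ.remaining j) :=
  Set.disjoint_left.2 fun _ hv hj =>
    (φ.remaining_antitone (Nat.succ_le_of_lt h) hj : _ ∈ φ.remaining (i + 1)).2 hv

end PlanarEmbedding

theorem exists_treeDecomposition {V : Type*} {G : SimpleGraph V} {k : ℕ} (hk : 0 < k)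
    (h : treewidth G = k) : ∃ (n : ℕ) (D : TreeDecomposition G (Fin n)),
      ∀ t, (D.bag t).card ≤ k + 1 := by
  -- An infimum over the empty set would be 0, so positive treewidth provides a decomposition.
  have hne : {k | ∃ (n : ℕ) (D : TreeDecomposition G (Fin n)), D.width = k}.Nonempty :=
    Nat.nonempty_of_pos_sInf (lt_of_lt_of_eq hk h.symm)
  obtain ⟨n, D, hD⟩ := Nat.sInf_mem hne
  refine ⟨n, D, fun t => ?_⟩
  have h1 : D.width = k := hD.trans h
  have h2 := Finset.le_sup (f := fun t => (D.bag t).card) (Finset.mem_univ t)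
  unfold TreeDecomposition.width at h1
  exact Nat.le_add_of_sub_le (h1 ▸ Nat.sub_le_sub_right h2 1)

end PlaneGraph

theorem mainTheorem2 {V : Type*} [Finite V] (G : SimpleGraph V)
    (φ : PlaneGraph.PlanarEmbedding G) (k : ℕ) (hk : 1 < k)
    (htw : PlaneGraph.treewidth G = k) (V₁ V₂ : Set V)
    (hV₁ : (G.induce V₁).Connected) (hV₂ : (G.induce V₂).Connected)
    (a b : ℕ) (ha : IsGreatest (φ.height '' V₁) (a : ℕ∞))
    (hb : IsLeast (φ.height '' V₂) (b : ℕ∞)) (hab : (k : ℤ) + 1 ≤ (b : ℤ) - (a : ℤ)) :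
    ∃ Y : Finset V, Y.card ≤ k ∧ PlaneGraph.StronglyDisconnects G (Y : Set V) V₁ V₂ := by
  open PlaneGraph in
  have hc₁ : ConnIn G V₁ := connIn_of_preconnected_induce hV₁.preconnected
  have hc₂ : ConnIn G V₂ := connIn_of_preconnected_induce hV₂.preconnected
  by_cases hW : ∃ W, ConnIn G W ∧ (W ∩ V₁).Nonempty ∧ (W ∩ V₂).Nonempty
  swap
  · refine ⟨∅, by simp, ?_, by simp⟩
    rintro ⟨K, ⟨x, hx, hx1⟩, y, hy, hy2⟩
    rw [SimpleGraph.ConnectedComponent.mem_supp_iff] at hx hy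
    have hr := reachIn_of_reachable_induce (SimpleGraph.ConnectedComponent.exact (hx.trans hy.symm))
    exact hW ⟨_, connIn_compIn G _ x, ⟨x, Relation.ReflTransGen.refl, hx1⟩, ⟨y, hr, hy2⟩⟩
  obtain ⟨W₀, hW₀, hW₁, hW₂⟩ := hW
  have hout₁ : Disjoint V₁ (φ.remaining a) := Set.disjoint_left.2 fun v hv =>
    φ.notMem_remaining_of_height_le (ha.2 (Set.mem_image_of_mem _ hv))
  have hin₂ : ∀ i < b, V₂ ⊆ φ.remaining i := fun i hi v hv =>
    φ.mem_remaining_of_lt_height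
      (lt_of_lt_of_le (Nat.cast_lt.2 hi) (hb.2 (Set.mem_image_of_mem _ hv)))
  have hout : ∀ i, Disjoint V₁ (φ.remaining (a + i)) := fun i =>
    hout₁.mono_right (φ.remaining_antitone (Nat.le_add_right a i))
  -- Layer `i` needs `V₁` removed after `a + i` rounds and `V₂` still present after `a + i + 1`; the
  -- latter holds because `a + i + 1 ≤ a + k < b`, so the gap `k + 1` gives exactly the `k` layers
  -- needed.
  choose C hCsub hC hne hsep using fun i : Fin k =>
    φ.exists_separating_coast_part (R := φ.remaining (a + i))
      (fun w hw => φ.pos_mem_outerFace_remaining _ hw) hc₂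
      (hin₂ (a + i + 1) (by have := i.2; omega)) (hout i) hW₀ hW₁ hW₂
  obtain ⟨n, D, hD⟩ := exists_treeDecomposition (by omega) htw
  have hn : Nonempty (Fin n) := D.isTree.connected.nonempty
  refine D.exists_stronglyDisconnects (by omega) hD hc₁ hc₂ (hW₁.mono Set.inter_subset_right)
    (hW₂.mono Set.inter_subset_right) (hout₁.mono_right (hin₂ a (by omega))) C hC hne ?_ ?_ ?_ hsep
  · have hlt : ∀ i j : Fin k, i < j → Disjoint (C i) (C j) := fun i j hij =>
      (φ.disjoint_coast_remaining (show a + (i : ℕ) < a + j by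
        have : (i : ℕ) < j := hij
        omega)).mono (hCsub i) ((hCsub j).trans (φ.coast_subset _))
    intro i j hij
    rcases lt_or_gt_of_ne hij with h | h
    · exact hlt i j h
    · exact (hlt j i h).symm
  · exact fun i => ((hout i).mono_right ((hCsub i).trans (φ.coast_subset _))).symm
  · exact fun i => (φ.disjoint_coast_remaining (Nat.lt_succ_self _)).mono (hCsub i)
      (hin₂ (a + i + 1) (by have := i.2; omega))
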